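/- Let $n\ge 1$ and $\mathbb K=\mathbb C(u,v)$, the field of rational functions in two indeterminates. Let $\mathcal E_n^{B}$ (the bt-algebra of type $B_n$) be the unital associative $\mathbb K$-algebra generated by $B_1$, $T_1,\dots,T_{n-1}$, $E_1,\dots,E_{n-1}$, $F_1,\dots,F_n$ subject to the following relations (for all indices for which they make sense), where $s_i$ is the transposition $(i,\,i+1)$: $$ \begin{aligned} &T_iT_j=T_jT_i,\quad E_iT_j=T_jE_i\quad(|i-j|>1), &&T_iT_{i+1}T_i=T_{i+1}T_iT_{i+1},\\ &T_i^2=1+(u-u^{-1})E_iT_i, && E_i^2=E_i,\quad E_iE_j=E_jE_i,\quad E_iT_i=T_iE_i,\\ &E_iE_jT_i=T_iE_iE_j=E_jT_iE_j\quad(|i-j|=1), && E_iT_jT_i=T_jT_iE_j\quad(|i-j|=1),\\ &B_1T_1B_1T_1=T_1B_1T_1B_1,\quad B_1T_i=T_iB_1\ (i>1), && B_1^2=1+(v-v^{-1})F_1B_1,\\ &B_1E_i=E_iB_1,\quad B_1F_j=F_jB_1, && F_j^2=F_j,\quad F_jE_i=E_iF_j,\\ &F_jT_i=T_iF_{s_i(j)},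 && E_iF_i=F_iF_{i+1}=E_iF_{i+1}. \end{aligned} $$ The elements $T_i$ are invertible, with $T_i^{-1}=T_i-(u-u^{-1})E_i$. For $1\le i<j\le n$ put $E_{i,j}=T_i\cdots T_{j-2}\,E_{j-1}\,T_{j-2}^{-1}\cdots T_i^{-1}$ (so $E_{i,i+1}=E_i$), and for $J\subseteq\{1,\dots,n\}$ put $E_J=\prod_{i<j,\ i,j\in J}E_{i,j}$ and $F_J=\prod_{j\in J}F_j$, empty products being $1$; the factors in these products commute. For a set partition $I$ of $\{0,1,\dots,n\}$, let $I_0$ be the block containing $0$ and $I_1,\dots,I_m$ the other blocks, and put $$EF_I=E_{I_1}\cdots E_{I_m}\,F_{I_0\setminus\{0\}}.$$ Let $W_n$ be the Coxeter group of type $B_n$ with Coxeter generators $r_1,s_1,\dots,s_{n-1}$ (the edge labelled $4$ joins $r_1$ and $s_1$). For $w\in W_n$ let $T_w$ be the product obtained from a reduced expression of $w$ by replacing $r_1$ by $B_1$ and each $s_i$ by $T_i$. **Theorem.** The element $T_w$ does not depend on the chosen reduced expression of $w$, and the elements $EF_I\,T_w$, where $I$ runs over the set partitions of $\{0,1,\dots,n\}$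 and $w$ over $W_n$, form a linear basis of $\mathcal E_n^{B}$ over $\mathbb K$ (different pairs $(I,w)$ giving different elements). In particular $\dim_{\mathbb K}\mathcal E_n^{B}=b_{n+1}\,2^n\,n!$, where $b_{n+1}$ is the $(n+1)$-st Bell number. -/

import Mathlib

namespace BtB

/-- The ground field `ℂ(u, v)` of rational functions in two indeterminates. -/
def K : Type := FractionRing (MvPolynomial (Fin 2) ℂ)

noncomputable instance : Field K := inferInstanceAs (Field (FractionRing (MvPolynomial (Fin 2) ℂ)))

noncomputable instance : Algebra (MvPolynomial (Fin 2) ℂ) K :=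
  inferInstanceAs (Algebra _ (FractionRing (MvPolynomial (Fin 2) ℂ)))

instance : IsFractionRing (MvPolynomial (Fin 2) ℂ) K :=
  inferInstanceAs (IsFractionRing _ (FractionRing (MvPolynomial (Fin 2) ℂ)))

/-- The indeterminate `u`. -/
noncomputable def u : K := algebraMap (MvPolynomial (Fin 2) ℂ) K (MvPolynomial.X 0)

/-- The indeterminate `v`. -/
noncomputable def v : K := algebraMap (MvPolynomial (Fin 2) ℂ) K (MvPolynomial.X 1)

/-! Moving strands `1, …, n` are indexed by `Fin n` (strand `j + 1` is the index `j`), and the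
positions `1, …, n - 1` by `Fin (n - 1)` (position `i + 1` is the index `i`). -/

/-- The strand `i` of the position `i` (the generators `T_i`, `E_i` involve strands `i, i + 1`). -/
def lo {n : ℕ} (i : Fin (n - 1)) : Fin n := ⟨i.val, by omega⟩

/-- The strand `i + 1` of the position `i`. -/
def hi {n : ℕ} (i : Fin (n - 1)) : Fin n := ⟨i.val + 1, by omega⟩

/-- The generators `B_1`, `T_1, …, T_{n-1}`, `E_1, …, E_{n-1}`, `F_1, …, F_n`. -/
inductive Gen (n : ℕ) : Type
  | b : Gen n
  | t (i : Fin (n - 1)) : Gen n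
  | e (i : Fin (n - 1)) : Gen n
  | f (j : Fin n) : Gen n

section Relations

variable {n : ℕ}

/-- The generator `B_1` in the free algebra. -/
noncomputable def b' : FreeAlgebra K (Gen n) := FreeAlgebra.ι K Gen.b

/-- The generator `T_i` in the free algebra. -/
noncomputable def t' (i : Fin (n - 1)) : FreeAlgebra K (Gen n) := FreeAlgebra.ι K (Gen.t i)

/-- The generator `E_i` in the free algebra. -/
noncomputable def e' (i : Fin (n - 1)) : FreeAlgebra K (Gen n) := FreeAlgebra.ι K (Gen.e i)

/-- The generator `F_j` in the free algebra. -/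
noncomputable def f' (j : Fin n) : FreeAlgebra K (Gen n) := FreeAlgebra.ι K (Gen.f j)

/-- `|i - j| > 1`. -/
def Far (i j : Fin (n - 1)) : Prop := i.val + 1 < j.val ∨ j.val + 1 < i.val

/-- `|i - j| = 1`. -/
def Near (i j : Fin (n - 1)) : Prop := i.val + 1 = j.val ∨ j.val + 1 = i.val

/-- The defining relations of the bt-algebra of type `B_n`. -/
inductive Rel (n : ℕ) : FreeAlgebra K (Gen n) → FreeAlgebra K (Gen n) → Prop
  | t_comm (i j : Fin (n - 1)) (h : Far i j) : Rel n (t' i * t' j) (t' j * t' i)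
  | t_braid (i j : Fin (n - 1)) (h : i.val + 1 = j.val) :
      Rel n (t' i * t' j * t' i) (t' j * t' i * t' j)
  | t_sq (i : Fin (n - 1)) : Rel n (t' i * t' i) (1 + (u - u⁻¹) • (e' i * t' i))
  | e_sq (i : Fin (n - 1)) : Rel n (e' i * e' i) (e' i)
  | e_comm (i j : Fin (n - 1)) : Rel n (e' i * e' j) (e' j * e' i)
  | e_t (i : Fin (n - 1)) : Rel n (e' i * t' i) (t' i * e' i)
  | e_t_far (i j : Fin (n - 1)) (h : Far i j) : Rel n (e' i * t' j) (t' j * e' i)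
  | e_e_t (i j : Fin (n - 1)) (h : Near i j) : Rel n (e' i * e' j * t' i) (t' i * e' i * e' j)
  | t_e_e (i j : Fin (n - 1)) (h : Near i j) : Rel n (t' i * e' i * e' j) (e' j * t' i * e' j)
  | e_t_t (i j : Fin (n - 1)) (h : Near i j) : Rel n (e' i * t' j * t' i) (t' j * t' i * e' j)
  | b_t_braid (i : Fin (n - 1)) (h : i.val = 0) :
      Rel n (b' * t' i * b' * t' i) (t' i * b' * t' i * b')
  | b_t_comm (i : Fin (n - 1)) (h : i.val ≠ 0) : Rel n (b' * t' i) (t' i * b')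
  | b_sq (j : Fin n) (h : j.val = 0) : Rel n (b' * b') (1 + (v - v⁻¹) • (f' j * b'))
  | b_e (i : Fin (n - 1)) : Rel n (b' * e' i) (e' i * b')
  | f_sq (j : Fin n) : Rel n (f' j * f' j) (f' j)
  | b_f (j : Fin n) : Rel n (b' * f' j) (f' j * b')
  | f_e (j : Fin n) (i : Fin (n - 1)) : Rel n (f' j * e' i) (e' i * f' j)
  | f_t (j : Fin n) (i : Fin (n - 1)) :
      Rel n (f' j * t' i) (t' i * f' (Equiv.swap (lo i) (hi i) j))
  | e_f_lo (i : Fin (n - 1)) : Rel n (e' i * f' (lo i)) (f' (lo i) * f' (hi i))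
  | e_f_hi (i : Fin (n - 1)) : Rel n (f' (lo i) * f' (hi i)) (e' i * f' (hi i))

end Relations

/-- The bt-algebra of type `B_n` (for `n ≥ 1`). -/
def BtAlg (n : ℕ) : Type := RingQuot (Rel n)

noncomputable instance (n : ℕ) : Ring (BtAlg n) := inferInstanceAs (Ring (RingQuot (Rel n)))

noncomputable instance (n : ℕ) : Algebra K (BtAlg n) :=
  inferInstanceAs (Algebra K (RingQuot (Rel n)))

section Elements

variable {n : ℕ}

/-- The canonical projection from the free algebra. -/
noncomputable def proj (n : ℕ) : FreeAlgebra K (Gen n) →ₐ[K] BtAlg n :=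
  (RingQuot.mkAlgHom K (Rel n) : FreeAlgebra K (Gen n) →ₐ[K] RingQuot (Rel n))

/-- The generator `B_1`. -/
noncomputable def B : BtAlg n := proj n b'

/-- The generators `T_i`. -/
noncomputable def T (i : Fin (n - 1)) : BtAlg n := proj n (t' i)

/-- The generators `E_i`. -/
noncomputable def E (i : Fin (n - 1)) : BtAlg n := proj n (e' i)

/-- The generators `F_j`. -/
noncomputable def F (j : Fin n) : BtAlg n := proj n (f' j)

theorem T_sq (i : Fin (n - 1)) : T i * T i = 1 + (u - u⁻¹) • (E i * T i) := by
  have h : proj n _ = proj n _ := RingQuot.mkAlgHom_rel K (Rel.t_sq i)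
  simpa only [T, E, map_mul, map_add, map_one, map_smul] using h

theorem E_T (i : Fin (n - 1)) : E i * T i = T i * E i := by
  have h : proj n _ = proj n _ := RingQuot.mkAlgHom_rel K (Rel.e_t i)
  simpa only [T, E, map_mul] using h

/-- `T_i` as a unit, with inverse `T_i - (u - u⁻¹) E_i`. -/
noncomputable def TUnit (i : Fin (n - 1)) : (BtAlg n)ˣ where
  val := T i
  inv := T i - (u - u⁻¹) • E i
  val_inv := by rw [mul_sub, T_sq, mul_smul_comm, ← E_T, add_sub_cancel_right]
  inv_val := by rw [sub_mul, T_sq, smul_mul_assoc, add_sub_cancel_right]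

/-- The unit `T_a T_{a+1} ⋯ T_{c-1}` (equal to `1` if `c ≤ a`). -/
noncomputable def TSeg (a c : ℕ) : (BtAlg n)ˣ :=
  (((List.finRange (n - 1)).filter fun k => a ≤ k.val ∧ k.val < c).map TUnit).prod

/-- For strands `a < b`, the element
`E_{a,b} = T_a ⋯ T_{b-2} E_{b-1} T_{b-2}⁻¹ ⋯ T_a⁻¹`, which is `E_a` for `b = a + 1`
(and the junk value `1` unless `a < b`). -/
noncomputable def EPair (a b : Fin n) : BtAlg n :=
  if h : a < b then
    ((TSeg a.val (b.val - 1) : (BtAlg n)ˣ) : BtAlg n) *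
      E ⟨b.val - 1, by have := b.isLt; have : a.val < b.val := h; omega⟩ *
      (((TSeg a.val (b.val - 1))⁻¹ : (BtAlg n)ˣ) : BtAlg n)
  else 1

/-- `E_J`, the product of the `E_{a,b}` over `a < b` in `J`. These factors commute; they are
multiplied in lexicographic order. -/
noncomputable def EBlock (J : Finset (Fin n)) : BtAlg n :=
  (((List.finRange n ×ˢ List.finRange n).filter
    fun p => p.1 ∈ J ∧ p.2 ∈ J ∧ p.1 < p.2).map fun p => EPair p.1 p.2).prod

/-- `F_A`, the product of the `F_j` over `j ∈ A`. These factors commute; they are multiplied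
in increasing order. -/
noncomputable def FSet (A : Finset (Fin n)) : BtAlg n :=
  (((List.finRange n).filter fun j => j ∈ A).map F).prod

/-- `A* = A \ {0}`, as a set of moving strands, for `A ⊆ {0, 1, …, n}`. -/
def star (A : Finset (Fin (n + 1))) : Finset (Fin n) :=
  Finset.univ.filter fun j => j.succ ∈ A

/-- A set partition of `{0, 1, …, n}`. -/
abbrev SetPart (n : ℕ) : Type := Finpartition (Finset.univ : Finset (Fin (n + 1)))

/-- The strands that are the minimum of a block not containing `0`, in increasing order. Hence
each block of `I` not containing `0` is `I.part j.succ` for exactly one `j` in the list. -/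
def leaders (I : SetPart n) : List (Fin n) :=
  (List.finRange n).filter fun j =>
    (0 : Fin (n + 1)) ∉ I.part j.succ ∧ ∀ k ∈ star (I.part j.succ), j ≤ k

/-- `EF_I = (∏ E_J) F_{I₀*}`, where `J` runs over the blocks of `I` not containing `0` and `I₀` is
the block containing `0`. -/
noncomputable def EF (I : SetPart n) : BtAlg n :=
  ((leaders I).map fun j => EBlock (star (I.part j.succ))).prod * FSet (star (I.part 0))

end Elements

section Weyl

/-- The Coxeter matrix of type `B_n`, with nodes `r_1, s_1, …, s_{n-1}` numbered
`0, 1, …, n - 1`; the edge labelled `4` joins the nodes `0` and `1`. -/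
def cox (n : ℕ) : CoxeterMatrix (Fin n) := (CoxeterMatrix.B n).reindex Fin.revPerm

/-- The Coxeter group of type `B_n`. -/
abbrev W (n : ℕ) : Type := (cox n).Group

/-- The Coxeter system of the Coxeter group of type `B_n`. -/
abbrev cs (n : ℕ) : CoxeterSystem (cox n) (W n) := (cox n).toCoxeterSystem

variable {n : ℕ}

/-- The generator of the algebra attached to a Coxeter generator: `r_1 ↦ B_1`, `s_i ↦ T_i`. -/
noncomputable def letter (i : Fin n) : BtAlg n :=
  if h : i.val = 0 then B else T ⟨i.val - 1, by omega⟩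

/-- The product of the generators of the algebra along a word in the Coxeter generators. -/
noncomputable def wordT (ω : List (Fin n)) : BtAlg n := (ω.map letter).prod

/-- `T_w`, the product along a reduced word of `w`. -/
noncomputable def TW (w : W n) : BtAlg n := wordT ((cs n).exists_isReduced w).choose

end Weyl

end BtB

/-! The argument has a combinatorial half, on the Coxeter group, and an algebraic half that shows
spanning and independence.

`W n` acts on `ℤ` by signed permutations. Descents of signed permutations give the exchange
condition (`exchange_signedSwap`). Matsumoto's theorem (`matsumoto`) is proved for any family of
involutions with that condition. Applied to the abstract generators of `W n`, it shows that the
action is faithful (`phi_injective`), so that reduced words are exactly the minimal words for signed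
permutations. Applied to the elements `letter s`, it shows that `T_w` is well defined.

Put `X 0 j = F_j` and `X i j = E_{i,j}`. These are commuting idempotents with `X a b * X b c = X a b
* X a c` (`isPartitionFamily_X`). A product of them therefore depends only on the equivalence
relation that its pairs generate, and `EF_I` is the product attached to the relation of `I`
(`EF_eq`). Conjugation by the generators permutes the `X a b` as `W n` permutes the strands, so each
relation among them is only needed on adjacent strands.

Spanning: the generators permute the idempotents, and `T_s T_w` is `T_{sw}` or `T_{sw}` plus a
multiple of `X T_w`, where `X` is the idempotent of `s`. Hence the span of the proposed basis
contains `1` and is stable under left multiplication by all generators (`span_basisElt`).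

Independence: on the free module with basis the pairs (equivalence relation, group element),
operators are defined by the formulas that left multiplication must obey. Their braid relations are
not computed directly. Operators of right multiplication are defined too, and commute with the left
ones (`opL_mul_opR`). An operator that commutes with all right multiplications is determined by its
value at the unit vector, where products along reduced words of one element agree. The module is
thus a representation of the algebra, and evaluation at the unit vector sends the proposed basis to
the standard one.

The dimension follows by counting: equivalence relations satisfy the Bell recurrence, and `W n` is
in bijection with signs and permutations. -/

namespace BtB

/-! ### Matsumoto's theorem from the exchange condition -/

section Matsumoto

variable {S Γ M : Type*} [Group Γ] [Monoid M]

/-- The alternating word `x y x y ⋯` of length `k`. -/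
def alt (x y : S) : ℕ → List S
  | 0 => []
  | k + 1 => x :: alt y x k

@[simp] theorem length_alt (x y : S) (k : ℕ) : (alt x y k).length = k := by
  induction k generalizing x y with
  | zero => rfl
  | succ k ih => simp [alt, ih]

theorem alt_add (x y : S) (k l : ℕ) : ∃ a b, alt x y (k + l) = alt x y k ++ alt a b l := by
  induction k generalizing x y with
  | zero => exact ⟨x, y, by simp [alt]⟩
  | succ k ih =>
    obtain ⟨a, b, h⟩ := ih y x
    exact ⟨a, b, by rw [Nat.succ_add]; simp [alt, h]⟩

/-- A word of minimal length among the words with the same product. -/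
def IsMin (σ : S → Γ) (ω : List S) : Prop :=
  ∀ ω' : List S, (ω'.map σ).prod = (ω.map σ).prod → ω.length ≤ ω'.length

theorem IsMin.of_append_right {σ : S → Γ} {ω₁ ω₂ : List S} (h : IsMin σ (ω₁ ++ ω₂)) :
    IsMin σ ω₂ := by
  intro ω' h'
  have := h (ω₁ ++ ω') (by simp [h'])
  simpa using this

theorem IsMin.of_append_left {σ : S → Γ} {ω₁ ω₂ : List S} (h : IsMin σ (ω₁ ++ ω₂)) :
    IsMin σ ω₁ := by
  intro ω' h'
  have := h (ω' ++ ω₂) (by simp [h'])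
  simpa using this

theorem IsMin.of_cons {σ : S → Γ} {s : S} {ω : List S} (h : IsMin σ (s :: ω)) : IsMin σ ω :=
  IsMin.of_append_right (ω₁ := [s]) h

theorem IsMin.congr {σ : S → Γ} {ω ω' : List S} (h : IsMin σ ω)
    (hp : (ω'.map σ).prod = (ω.map σ).prod) (hl : ω'.length = ω.length) : IsMin σ ω' := by
  intro ω'' h''
  rw [hl]
  exact h _ (h''.trans hp)

theorem IsMin.length_eq {σ : S → Γ} {ω ω' : List S} (h : IsMin σ ω) (h' : IsMin σ ω')
    (hp : (ω'.map σ).prod = (ω.map σ).prod) : ω.length = ω'.length :=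
  le_antisymm (h _ hp) (h' _ hp.symm)

/-- The exchange condition for a family of involutions. -/
def Exchange (σ : S → Γ) : Prop :=
  ∀ (ω : List S) (t : S), IsMin σ ω → ¬ IsMin σ (t :: ω) →
    ∃ ω₁ x ω₂, ω = ω₁ ++ x :: ω₂ ∧ σ t * (ω₁.map σ).prod = (ω₁.map σ).prod * σ x


/-- Since `t` shortens the product of `ω`, exchange removes a letter of `ω` and puts `t` in front.
The new word shares its first letter with `t :: β`, so by induction it has the same `f`-value. Had
the removed letter not been the last one, the new word would share its last letter with `ω`, and
induction would contradict the assumption that the `f`-values differ. -/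
theorem exchange_step {σ : S → Γ} (hσ : ∀ s, σ s * σ s = 1) (hex : Exchange σ) (f : S → M) {k : ℕ}
    (ih : ∀ ω ω' : List S, ω.length = k → IsMin σ ω → IsMin σ ω' →
      (ω.map σ).prod = (ω'.map σ).prod → (ω.map f).prod = (ω'.map f).prod)
    {ω β : List S} {t : S} (hl : ω.length = k + 1) (hω : IsMin σ ω) (hβ : IsMin σ (t :: β))
    (hp : (ω.map σ).prod = ((t :: β).map σ).prod)
    (hf : (ω.map f).prod ≠ ((t :: β).map f).prod) :
    IsMin σ (t :: ω.dropLast) ∧ ((t :: ω.dropLast).map σ).prod = (ω.map σ).prod ∧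
      ((t :: ω.dropLast).map f).prod = ((t :: β).map f).prod := by
  have hlen : ω.length = (t :: β).length := hω.length_eq hβ hp.symm
  have hnot : ¬ IsMin σ (t :: ω) := by
    intro h
    have := h β (by
      rw [List.map_cons, List.prod_cons, hp, List.map_cons, List.prod_cons, ← mul_assoc, hσ,
        one_mul])
    simp only [List.length_cons] at this hlen
    omega
  obtain ⟨ω₁, x, ω₂, rfl, hx⟩ := hex ω t hω hnot
  have hγp : ((t :: (ω₁ ++ ω₂)).map σ).prod = ((ω₁ ++ x :: ω₂).map σ).prod := by
    simp only [List.map_cons, List.map_append, List.prod_cons, List.prod_append]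
    rw [← mul_assoc, hx, mul_assoc]
  have hγl : (t :: (ω₁ ++ ω₂)).length = (ω₁ ++ x :: ω₂).length := by simp; omega
  have hγ : IsMin σ (t :: (ω₁ ++ ω₂)) := hω.congr hγp hγl
  have hγf : ((t :: (ω₁ ++ ω₂)).map f).prod = ((t :: β).map f).prod := by
    simp only [List.map_cons, List.prod_cons]
    congr 1
    refine ih _ _ ?_ hγ.of_cons hβ.of_cons ?_
    · simp at hl hγl ⊢; omega
    · have := hγp.trans hp
      simpa only [List.map_cons, List.prod_cons, mul_right_inj] using this
  rcases List.eq_nil_or_concat ω₂ with rfl | ⟨ω₃, z, rfl⟩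
  · simp only [List.append_nil] at hγ hγp hγf
    simpa using ⟨hγ, by simpa using hγp, by simpa using hγf⟩
  -- The removed letter is not the last: both words end in `z`, and cancelling `z` leaves words of
  -- length `k`.
  · exfalso
    apply hf
    rw [← hγf]
    have h1 : t :: (ω₁ ++ ω₃.concat z) = (t :: (ω₁ ++ ω₃)) ++ [z] := by simp
    have h2 : ω₁ ++ x :: ω₃.concat z = (ω₁ ++ x :: ω₃) ++ [z] := by simp
    rw [h1] at hγ hγp ⊢
    rw [h2] at hω hγp hl ⊢
    have h3 := ih _ _ (by simp at hl ⊢; omega) hω.of_append_left hγ.of_append_left (by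
      rw [List.map_append (l₁ := t :: _), List.prod_append,
        List.map_append (l₁ := ω₁ ++ _), List.prod_append] at hγp
      exact (mul_right_cancel hγp).symm)
    rw [List.map_append (l₁ := t :: _), List.prod_append,
        List.map_append (l₁ := ω₁ ++ _), List.prod_append, h3]

/-- **Matsumoto's theorem** for a family of involutions that satisfies the exchange condition. -/
theorem matsumoto {σ : S → Γ} (hσ : ∀ s, σ s * σ s = 1) (hex : Exchange σ) (f : S → M)
    (hf : ∀ (x y : S) (k : ℕ), x ≠ y → 1 ≤ k → IsMin σ (alt x y k) →
      ((alt x y k).map σ).prod = ((alt y x k).map σ).prod →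
      ((alt x y k).map f).prod = ((alt y x k).map f).prod)
    {ω ω' : List S} (hω : IsMin σ ω) (hω' : IsMin σ ω')
    (hp : (ω.map σ).prod = (ω'.map σ).prod) : (ω.map f).prod = (ω'.map f).prod := by
  induction hk : ω.length generalizing ω ω' with
  | zero =>
    have := hω.length_eq hω' hp.symm
    rw [hk] at this
    rw [List.length_eq_zero_iff.1 hk, List.length_eq_zero_iff.1 this.symm]
  | succ k IH =>
    have ih : ∀ ω ω' : List S, ω.length = k → IsMin σ ω → IsMin σ ω' →
      (ω.map σ).prod = (ω'.map σ).prod → (ω.map f).prod = (ω'.map f).prod :=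
      fun ω ω' h1 h2 h3 h4 => IH h2 h3 h4 h1
    by_contra hne
    -- A counterexample yields counterexamples with longer and longer alternating beginnings:
    -- applying `exchange_step` to both words prepends the opposite first letter to each and drops
    -- its last letter. At full length the words are alternating and contradict `hf`.
    have key : ∀ j, 1 ≤ j → j ≤ k + 1 → ∃ x y ρ ρ', (alt x y j ++ ρ).length = k + 1 ∧
        IsMin σ (alt x y j ++ ρ) ∧ IsMin σ (alt y x j ++ ρ') ∧
        ((alt x y j ++ ρ).map σ).prod = ((alt y x j ++ ρ').map σ).prod ∧
        ((alt x y j ++ ρ).map f).prod ≠ ((alt y x j ++ ρ').map f).prod := by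
      intro j hj
      induction j, hj using Nat.le_induction with
      | base =>
        intro _
        have hl' := hω.length_eq hω' hp.symm
        obtain ⟨s, α, rfl⟩ := List.exists_cons_of_length_eq_add_one hk
        obtain ⟨t, β, rfl⟩ := List.exists_cons_of_length_eq_add_one (hl'.symm.trans hk)
        exact ⟨s, t, α, β, hk, hω, hω', hp, hne⟩
      | succ j hj ihj =>
        intro hjk
        obtain ⟨x, y, ρ, ρ', hl, h1, h2, h3, h4⟩ := ihj (by omega)
        have hl' : (alt y x j ++ ρ').length = k + 1 := (h1.length_eq h2 h3.symm).symm.trans hl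
        obtain ⟨i, rfl⟩ : ∃ i, j = i + 1 := ⟨j - 1, by omega⟩
        have hρ : ρ ≠ [] := by rintro rfl; simp at hl; omega
        have hρ' : ρ' ≠ [] := by rintro rfl; simp at hl'; omega
        obtain ⟨a1, a2, a3⟩ := exchange_step hσ hex f ih (t := y) (β := alt x y i ++ ρ') hl h1 h2
          h3 h4
        obtain ⟨b1, b2, b3⟩ := exchange_step hσ hex f ih (t := x) (β := alt y x i ++ ρ) hl' h2 h1
          h3.symm h4.symm
        rw [List.dropLast_append_of_ne_nil hρ] at a1 a2 a3
        rw [List.dropLast_append_of_ne_nil hρ'] at b1 b2 b3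
        refine ⟨x, y, ρ'.dropLast, ρ.dropLast, ?_, b1, a1, ?_, ?_⟩
        · have : ρ'.length ≠ 0 := by simpa using hρ'
          simp at hl' ⊢; omega
        · exact b2.trans (h3.symm.trans a2.symm)
        · intro h
          exact h4 (b3.symm.trans (h.trans a3))
    obtain ⟨x, y, ρ, ρ', hl, h1, h2, h3, h4⟩ := key (k + 1) (by omega) le_rfl
    have hl' : (alt y x (k + 1) ++ ρ').length = k + 1 := (h1.length_eq h2 h3.symm).symm.trans hl
    obtain rfl : ρ = [] := by simpa using hl
    obtain rfl : ρ' = [] := by simpa using hl'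
    simp only [List.append_nil] at *
    refine h4 (hf x y _ ?_ (by omega) h1 h3)
    rintro rfl
    exact h4 rfl

end Matsumoto

/-! ### Signed permutations of the integers and their braid relations -/

section SignedPerm

variable {n : ℕ}

/-- The first entry of the pair of integers attached to a node: `-1` for the node `0`, and `s` for
a node `s > 0`. -/
def loZ (s : Fin n) : ℤ := if s.val = 0 then -1 else s.val

/-- The second entry of the pair of integers attached to a node. -/
def hiZ (s : Fin n) : ℤ := s.val + 1

/-- With the pair `(-1, 1)` for the node `0`, every node exchanges its two integers together with
their negatives, and descents have one uniform definition. The disjunctive form here and in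
`signedSwapFun_spec` lets `omega` decide the cases. -/
theorem loZ_hiZ (s : Fin n) : (s.val = 0 ∧ loZ s = -1 ∧ hiZ s = 1) ∨
    (0 < s.val ∧ loZ s = s.val ∧ hiZ s = s.val + 1) := by
  unfold loZ hiZ
  split_ifs with h
  · left; simp [h]
  · right; simp; omega

/-- The signed transposition attached to a node, as a function on the integers. -/
def signedSwapFun (s : Fin n) (x : ℤ) : ℤ :=
  if x = loZ s then hiZ s else if x = hiZ s then loZ s else
  if x = -loZ s then -hiZ s else if x = -hiZ s then -loZ s else x

theorem signedSwapFun_spec (s : Fin n) (x : ℤ) :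
    (x = loZ s ∧ signedSwapFun s x = hiZ s) ∨ (x = hiZ s ∧ signedSwapFun s x = loZ s) ∨
    (x = -loZ s ∧ signedSwapFun s x = -hiZ s) ∨ (x = -hiZ s ∧ signedSwapFun s x = -loZ s) ∨
    (x ≠ loZ s ∧ x ≠ hiZ s ∧ x ≠ -loZ s ∧ x ≠ -hiZ s ∧ signedSwapFun s x = x) := by
  unfold signedSwapFun
  split_ifs <;> simp_all

theorem signedSwapFun_signedSwapFun (s : Fin n) (x : ℤ) :
    signedSwapFun s (signedSwapFun s x) = x := by
  have h1 := signedSwapFun_spec s x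
  have h2 := signedSwapFun_spec s (signedSwapFun s x)
  have h3 := loZ_hiZ s
  omega

/-- The signed transposition attached to a node. -/
def signedSwap (s : Fin n) : Equiv.Perm ℤ where
  toFun := signedSwapFun s
  invFun := signedSwapFun s
  left_inv := signedSwapFun_signedSwapFun s
  right_inv := signedSwapFun_signedSwapFun s

theorem signedSwap_spec (s : Fin n) (x : ℤ) :
    (x = loZ s ∧ signedSwap s x = hiZ s) ∨ (x = hiZ s ∧ signedSwap s x = loZ s) ∨
    (x = -loZ s ∧ signedSwap s x = -hiZ s) ∨ (x = -hiZ s ∧ signedSwap s x = -loZ s) ∨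
    (x ≠ loZ s ∧ x ≠ hiZ s ∧ x ≠ -loZ s ∧ x ≠ -hiZ s ∧ signedSwap s x = x) :=
  signedSwapFun_spec s x

theorem signedSwap_mul_self (s : Fin n) : signedSwap s * signedSwap s = 1 :=
  Equiv.ext (signedSwapFun_signedSwapFun s)

theorem signedSwap_inv (s : Fin n) : (signedSwap s)⁻¹ = signedSwap s := rfl

theorem signedSwap_neg (s : Fin n) (x : ℤ) : signedSwap s (-x) = -signedSwap s x := by
  have h1 := signedSwap_spec s x
  have h2 := signedSwap_spec s (-x)
  have h3 := loZ_hiZ s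
  omega

/-- The braid relations of type `B_n`. -/
structure IsBraidFamily {M : Type*} [Monoid M] (f : Fin n → M) : Prop where
  comm : ∀ s t : Fin n, s.val + 1 < t.val → f s * f t = f t * f s
  braid : ∀ s t : Fin n, 0 < s.val → s.val + 1 = t.val → f s * f t * f s = f t * f s * f t
  braid₄ : ∀ s t : Fin n, s.val = 0 → t.val = 1 →
    f s * f t * f s * f t = f t * f s * f t * f s

set_option maxHeartbeats 2000000 in
theorem isBraidFamily_signedSwap : IsBraidFamily (signedSwap (n := n)) where
  comm s t h := by
    ext x
    simp only [Equiv.Perm.mul_apply]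
    have h1 := signedSwap_spec s x
    have h2 := signedSwap_spec t x
    have h3 := signedSwap_spec s (signedSwap t x)
    have h4 := signedSwap_spec t (signedSwap s x)
    have h5 := loZ_hiZ s
    have h6 := loZ_hiZ t
    omega
  braid s t h0 h := by
    ext x
    simp only [Equiv.Perm.mul_apply]
    have h5 := loZ_hiZ s
    have h6 := loZ_hiZ t
    generalize ha : (s.val : ℤ) = a at *
    have h7 : (t.val : ℤ) = a + 1 := by omega
    have h8 : loZ s = a := by omega
    have h9 : hiZ s = a + 1 := by omega
    have h10 : loZ t = a + 1 := by omega
    have h11 : hiZ t = a + 2 := by omega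
    have h12 : 0 < a := by omega
    clear h5 h6
    have hs := signedSwap_spec s
    have ht := signedSwap_spec t
    rw [h8, h9] at hs
    rw [h10, h11] at ht
    rcases hs x with h1 | h1 | h1 | h1 | h1 <;>
    rcases ht (signedSwap s x) with h2 | h2 | h2 | h2 | h2 <;> (try omega) <;>
    rcases hs (signedSwap t (signedSwap s x)) with h3 | h3 | h3 | h3 | h3 <;> (try omega) <;>
    rcases ht x with h4 | h4 | h4 | h4 | h4 <;> (try omega) <;>
    rcases hs (signedSwap t x) with h5 | h5 | h5 | h5 | h5 <;> (try omega) <;>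
    rcases ht (signedSwap s (signedSwap t x)) with h6 | h6 | h6 | h6 | h6 <;> (try omega)
  braid₄ s t h0 h := by
    ext x
    simp only [Equiv.Perm.mul_apply]
    have h5 := loZ_hiZ s
    have h6 := loZ_hiZ t
    have hs := signedSwap_spec s
    have ht := signedSwap_spec t
    rw [show loZ s = -1 by omega, show hiZ s = 1 by omega] at hs
    rw [show loZ t = 1 by omega, show hiZ t = 2 by omega] at ht
    clear h5 h6
    rcases hs x with h1 | h1 | h1 | h1 | h1 <;>
    rcases ht (signedSwap s x) with h2 | h2 | h2 | h2 | h2 <;> (try omega) <;>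
    rcases hs (signedSwap t (signedSwap s x)) with h3 | h3 | h3 | h3 | h3 <;> (try omega) <;>
    rcases ht (signedSwap s (signedSwap t (signedSwap s x))) with h4 | h4 | h4 | h4 | h4 <;> (try omega) <;>
    rcases ht x with h5 | h5 | h5 | h5 | h5 <;> (try omega) <;>
    rcases hs (signedSwap t x) with h6 | h6 | h6 | h6 | h6 <;> (try omega) <;>
    rcases ht (signedSwap s (signedSwap t x)) with h7 | h7 | h7 | h7 | h7 <;> (try omega) <;>
    rcases hs (signedSwap t (signedSwap s (signedSwap t x))) with h8 | h8 | h8 | h8 | h8 <;> (try omega)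

end SignedPerm

/-! ### Braid relations and maps out of the Coxeter group -/

section Lift

variable {n : ℕ}

theorem cox_apply (s t : Fin n) : cox n s t = if s = t then 1 else
    if s.val = 0 ∧ t.val = 1 ∨ t.val = 0 ∧ s.val = 1 then 4 else
    if s.val + 1 = t.val ∨ t.val + 1 = s.val then 3 else 2 := by
  have hs := s.isLt
  have ht := t.isLt
  rw [cox, CoxeterMatrix.reindex_apply]
  simp only [CoxeterMatrix.B, Matrix.of_apply, Fin.revPerm_symm, Fin.revPerm_apply, Fin.rev_inj,
    Fin.val_rev]
  split_ifs <;> first | rfl | (exfalso; omega)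

/-- The Coxeter exponent of two different nodes. -/
theorem cox_cases {s t : Fin n} (h : s.val < t.val) :
    (s.val + 1 < t.val ∧ cox n s t = 2) ∨ (0 < s.val ∧ s.val + 1 = t.val ∧ cox n s t = 3) ∨
    (s.val = 0 ∧ t.val = 1 ∧ cox n s t = 4) := by
  rw [cox_apply]
  have : s ≠ t := by rintro rfl; omega
  split_ifs <;> omega

theorem IsBraidFamily.alt_eq {M : Type*} [Monoid M] {f : Fin n → M} (hf : IsBraidFamily f)
    {s t : Fin n} (h : s ≠ t) :
    ((alt s t (cox n s t)).map f).prod = ((alt t s (cox n s t)).map f).prod := by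
  wlog hst : s.val < t.val generalizing s t
  · rw [(cox n).symmetric]
    exact (this h.symm (by have := Fin.val_ne_of_ne h; omega)).symm
  rcases cox_cases hst with ⟨h1, h2⟩ | ⟨h1, h2, h3⟩ | ⟨h1, h2, h3⟩
  · simpa [h2, alt] using hf.comm s t h1
  · simpa [h3, alt, mul_assoc] using hf.braid s t h1 h2
  · simpa [h3, alt, mul_assoc] using hf.braid₄ s t h1 h2

theorem IsBraidFamily.isLiftable {M : Type*} [Monoid M] {f : Fin n → M} (hf : IsBraidFamily f)
    (h2 : ∀ s, f s * f s = 1) : (cox n).IsLiftable f := by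
  intro s t
  by_cases hst : s = t
  · subst hst; simp [h2]
  wlog h : s.val < t.val generalizing s t
  · have h' := this t s (Ne.symm hst) (by have := Fin.val_ne_of_ne hst; omega)
    rw [(cox n).symmetric]
    -- The order of the two nodes is irrelevant: `(st)^k = (st)^k s s = s (ts)^k s`.
    rw [← mul_one ((f s * f t) ^ _), ← h2 s, ← mul_assoc, mul_pow_mul, h', mul_one]
  have c : ∀ s x, f s * (f s * x) = x := fun s x => by rw [← mul_assoc, h2, one_mul]
  rcases cox_cases h with ⟨h1, h2'⟩ | ⟨h1, h2', h3⟩ | ⟨h1, h2', h3⟩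
  · rw [h2', pow_two]
    nth_rewrite 1 [hf.comm s t h1]
    simp [mul_assoc, c, h2]
  · have := hf.braid s t h1 h2'
    rw [h3, pow_succ, pow_two]
    calc _ = (f s * f t * f s) * (f t * f s * f t) := by simp only [mul_assoc]
      _ = 1 := by rw [this]; simp [mul_assoc, c, h2]
  · have := hf.braid₄ s t h1 h2'
    rw [h3]
    calc _ = (f s * f t * f s * f t) * (f s * f t * f s * f t) := by
          simp only [pow_succ, pow_zero, one_mul, mul_assoc]
      _ = 1 := by nth_rewrite 1 [this]; simp [mul_assoc, c, h2]

theorem isBraidFamily_simple : IsBraidFamily (cs n).simple := by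
  refine ⟨fun s t h => ?_, fun s t h0 h => ?_, fun s t h0 h => ?_⟩
  · have e : cox n s t = 2 := by rcases cox_cases (s := s) (t := t) (by omega) with h | h | h <;> omega
    have := (cs n).simple_mul_simple_pow s t
    rw [e, pow_two] at this
    rw [eq_inv_of_mul_eq_one_left this]; simp only [mul_inv_rev, CoxeterSystem.inv_simple]
  · have e : cox n s t = 3 := by rcases cox_cases (s := s) (t := t) (by omega) with h | h | h <;> omega
    have := (cs n).simple_mul_simple_pow s t
    rw [e, pow_succ, pow_two] at this
    have := eq_inv_of_mul_eq_one_left (a := (cs n).simple s * (cs n).simple t * (cs n).simple s)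
      (b := (cs n).simple t * (cs n).simple s * (cs n).simple t) (by simpa only [mul_assoc] using this)
    rw [this]; simp only [mul_inv_rev, CoxeterSystem.inv_simple, mul_assoc]
  · have e : cox n s t = 4 := by rcases cox_cases (s := s) (t := t) (by omega) with h | h | h <;> omega
    have := (cs n).simple_mul_simple_pow s t
    rw [e, show 4 = 2 + 2 from rfl, pow_add, pow_two] at this
    have := eq_inv_of_mul_eq_one_left (a := (cs n).simple s * (cs n).simple t * (cs n).simple s *
        (cs n).simple t)
      (b := (cs n).simple s * (cs n).simple t * (cs n).simple s * (cs n).simple t)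
      (by simpa only [mul_assoc] using this)
    rw [this]; simp only [mul_inv_rev, CoxeterSystem.inv_simple, mul_assoc]

/-- The action of `W_n` on the integers by signed permutations. -/
noncomputable def phi : W n →* Equiv.Perm ℤ :=
  (cs n).lift ⟨signedSwap, isBraidFamily_signedSwap.isLiftable signedSwap_mul_self⟩

theorem phi_simple (s : Fin n) : phi ((cs n).simple s) = signedSwap s :=
  (cs n).lift_apply_simple _ s

theorem phi_wordProd (ω : List (Fin n)) : phi ((cs n).wordProd ω) = (ω.map signedSwap).prod := by
  induction ω with
  | nil => simp
  | cons s ω ih => rw [CoxeterSystem.wordProd_cons, map_mul, phi_simple, ih, List.map_cons, List.prod_cons]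

end Lift

/-! ### Descents, the exchange condition and faithfulness of the signed action -/

section Descents

variable {n : ℕ}

/-- `t` is a right descent of the signed permutation `g`. -/
def Desc (g : Equiv.Perm ℤ) (t : Fin n) : Prop := g (hiZ t) < g (loZ t)

/-- The signed permutation `g` maps the root of `t` to the root of `s`, up to sign. -/
def RootPair (g : Equiv.Perm ℤ) (s t : Fin n) : Prop :=
  (g (loZ t) = loZ s ∧ g (hiZ t) = hiZ s) ∨ (g (loZ t) = hiZ s ∧ g (hiZ t) = loZ s) ∨
  (g (loZ t) = -loZ s ∧ g (hiZ t) = -hiZ s) ∨ (g (loZ t) = -hiZ s ∧ g (hiZ t) = -loZ s)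

theorem not_desc_one (t : Fin n) : ¬ Desc 1 t := by
  have := loZ_hiZ t
  simp only [Desc, Equiv.Perm.one_apply]
  omega

theorem signedSwap_loZ (t : Fin n) : signedSwap t (loZ t) = hiZ t := by
  have := loZ_hiZ t
  have := signedSwap_spec t (loZ t)
  omega

theorem signedSwap_hiZ (t : Fin n) : signedSwap t (hiZ t) = loZ t := by
  have := loZ_hiZ t
  have := signedSwap_spec t (hiZ t)
  omega

theorem desc_mul_signedSwap (g : Equiv.Perm ℤ) (t : Fin n) :
    Desc (g * signedSwap t) t ↔ ¬ Desc g t := by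
  have h := loZ_hiZ t
  have : g (loZ t) ≠ g (hiZ t) := g.injective.ne (by omega)
  simp only [Desc, Equiv.Perm.mul_apply, signedSwap_loZ, signedSwap_hiZ]
  omega

variable {g : Equiv.Perm ℤ} (hg : ∀ x, g (-x) = -g x)
include hg

/-- The swap of `s` reverses the order of two nonzero integers only if they are the pair of `s`, up
to sign and order. So only then can it change whether `t` is a descent. -/
theorem rootPair_of_desc {s t : Fin n} (h : ¬ (Desc (signedSwap s * g) t ↔ Desc g t)) :
    RootPair g s t := by
  have ht := loZ_hiZ t
  have hs := loZ_hiZ s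
  -- For the node `0` the swap also reverses the order of `0` and `±1`, so the value `0` has to be
  -- excluded.
  have h0 : g 0 = 0 := by have := hg 0; simp at this; omega
  have h1 : g (loZ t) ≠ g (hiZ t) := g.injective.ne (by omega)
  have h2 : g (loZ t) ≠ g 0 := g.injective.ne (by omega)
  have h3 : g (hiZ t) ≠ g 0 := g.injective.ne (by omega)
  simp only [Desc, Equiv.Perm.mul_apply] at h
  unfold RootPair
  have h' : signedSwap s (g (hiZ t)) < signedSwap s (g (loZ t)) ∧ g (loZ t) < g (hiZ t) ∨
      signedSwap s (g (loZ t)) ≤ signedSwap s (g (hiZ t)) ∧ g (hiZ t) < g (loZ t) := by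
    by_contra h''
    apply h
    constructor <;> intro _ <;> omega
  clear h ht
  rcases h' with ⟨ha, hb⟩ | ⟨ha, hb⟩ <;> rcases hs with ⟨_, hs⟩ | ⟨_, hs⟩ <;>
  rcases signedSwap_spec s (g (loZ t)) with h4 | h4 | h4 | h4 | h4 <;>
  rcases signedSwap_spec s (g (hiZ t)) with h5 | h5 | h5 | h5 | h5 <;>
  first
  | (exfalso; omega)
  | exact Or.inl ⟨by omega, by omega⟩
  | exact Or.inr (Or.inl ⟨by omega, by omega⟩)
  | exact Or.inr (Or.inr (Or.inl ⟨by omega, by omega⟩))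
  | exact Or.inr (Or.inr (Or.inr ⟨by omega, by omega⟩))

theorem RootPair.conj {s t : Fin n} (h : RootPair g s t) :
    signedSwap s * g = g * signedSwap t := by
  have ht := loZ_hiZ t
  have hs := loZ_hiZ s
  ext x
  simp only [Equiv.Perm.mul_apply]
  have h1 := hg (loZ t)
  have h2 := hg (hiZ t)
  have h3 := signedSwap_spec s (g x)
  rcases signedSwap_spec t x with ⟨h4, h5⟩ | ⟨h4, h5⟩ | ⟨h4, h5⟩ | ⟨h4, h5⟩ |
    ⟨h4, h5, h6, h7, h8⟩
  · rw [h5]; subst h4; rcases h with h | h | h | h <;> omega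
  · rw [h5]; subst h4; rcases h with h | h | h | h <;> omega
  · rw [h5]; subst h4; rcases h with h | h | h | h <;> omega
  · rw [h5]; subst h4; rcases h with h | h | h | h <;> omega
  · rw [h8]
    have h4 := g.injective.ne h4
    have h5 := g.injective.ne h5
    have h6 := g.injective.ne h6
    have h7 := g.injective.ne h7
    rcases h with h | h | h | h <;> omega

/-- Only the node `0` has a pair of opposite integers, and `g` is odd. -/
theorem RootPair.zero_iff {s t : Fin n} (h : RootPair g s t) : s.val = 0 ↔ t.val = 0 := by
  have ht := loZ_hiZ t
  have hs := loZ_hiZ s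
  have h2 := hg (hiZ t)
  have h3 : t.val ≠ 0 → g (loZ t) ≠ g (- hiZ t) := fun _ => g.injective.ne (by omega)
  constructor
  · intro h'
    by_contra h4
    have := h3 h4
    rcases h with h | h | h | h <;> omega
  · intro h'
    have : g (loZ t) = g (-hiZ t) := by congr 1; omega
    rcases h with h | h | h | h <;> omega

theorem RootPair.desc_iff {s t : Fin n} (h : RootPair g s t) : Desc g t ↔ Desc g⁻¹ s := by
  have ht := loZ_hiZ t
  have hs := loZ_hiZ s
  have h1 := hg (loZ t)
  have h2 := hg (hiZ t)
  unfold Desc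
  rcases h with h | h | h | h
  · rw [show g⁻¹ (hiZ s) = hiZ t by rw [Equiv.Perm.inv_eq_iff_eq]; omega,
      show g⁻¹ (loZ s) = loZ t by rw [Equiv.Perm.inv_eq_iff_eq]; omega]
    omega
  · rw [show g⁻¹ (hiZ s) = loZ t by rw [Equiv.Perm.inv_eq_iff_eq]; omega,
      show g⁻¹ (loZ s) = hiZ t by rw [Equiv.Perm.inv_eq_iff_eq]; omega]
    omega
  · rw [show g⁻¹ (hiZ s) = -hiZ t by rw [Equiv.Perm.inv_eq_iff_eq]; omega,
      show g⁻¹ (loZ s) = -loZ t by rw [Equiv.Perm.inv_eq_iff_eq]; omega]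
    omega
  · rw [show g⁻¹ (hiZ s) = -loZ t by rw [Equiv.Perm.inv_eq_iff_eq]; omega,
      show g⁻¹ (loZ s) = -hiZ t by rw [Equiv.Perm.inv_eq_iff_eq]; omega]
    omega

omit hg

theorem signedProd_neg (ω : List (Fin n)) (x : ℤ) :
    (ω.map signedSwap).prod (-x) = -(ω.map signedSwap).prod x := by
  induction ω with
  | nil => simp
  | cons s ω ih => simp [ih, signedSwap_neg]

theorem inv_neg_of_neg {g : Equiv.Perm ℤ} (hg : ∀ x, g (-x) = -g x) (x : ℤ) :
    g⁻¹ (-x) = -g⁻¹ x := by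
  rw [Equiv.Perm.inv_eq_iff_eq, hg, show g (g⁻¹ x) = x from g.apply_symm_apply x]

/-- The identity has no descents, so the descent at `t` must appear when some letter `x` is appended
to a prefix. At that moment the inverse of the prefix matches the pairs of `t` and `x`, and
`RootPair.conj` gives the exchange relation. -/
theorem exchange_of_desc (ω : List (Fin n)) (t : Fin n)
    (h : Desc ((ω.map signedSwap).prod)⁻¹ t) : ∃ ω₁ x ω₂, ω = ω₁ ++ x :: ω₂ ∧
      signedSwap t * (ω₁.map signedSwap).prod = (ω₁.map signedSwap).prod * signedSwap x := by
  induction ω using List.reverseRecOn with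
  | nil => exact absurd h (by simpa using not_desc_one t)
  | append_singleton ω x ih =>
    by_cases h' : Desc ((ω.map signedSwap).prod)⁻¹ t
    · obtain ⟨ω₁, y, ω₂, rfl, h2⟩ := ih h'
      exact ⟨ω₁, y, ω₂ ++ [x], by simp, h2⟩
    · refine ⟨ω, x, [], rfl, ?_⟩
      have hg := inv_neg_of_neg (signedProd_neg ω)
      have := (rootPair_of_desc (s := x) (t := t) hg (by
        intro h3
        apply h'
        rw [← h3]
        simpa [signedSwap_inv] using h)).conj hg
      rw [eq_inv_mul_iff_mul_eq, ← mul_assoc, mul_inv_eq_iff_eq_mul] at this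
      exact this.symm

theorem not_isMin_of_desc {ω : List (Fin n)} {t : Fin n}
    (h : Desc ((ω.map signedSwap).prod)⁻¹ t) : ¬ IsMin signedSwap (t :: ω) := by
  obtain ⟨ω₁, x, ω₂, rfl, hx⟩ := exchange_of_desc ω t h
  intro hmin
  have := hmin (ω₁ ++ ω₂) (by
    simp only [List.map_cons, List.map_append, List.prod_cons, List.prod_append]
    rw [← mul_assoc, hx, mul_assoc, ← mul_assoc (signedSwap x), signedSwap_mul_self, one_mul])
  simp at this

/-- A shorter word for `t :: ω` would have a descent at `t`, because multiplication by `t` reverses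
this property. Exchange would then delete a letter and give a word for `ω` shorter than `ω`. -/
theorem isMin_cons_of_not_desc {ω : List (Fin n)} {t : Fin n} (hω : IsMin signedSwap ω)
    (h : ¬ Desc ((ω.map signedSwap).prod)⁻¹ t) : IsMin signedSwap (t :: ω) := by
  intro ω' h'
  by_contra hlt
  obtain ⟨ω₁, x, ω₂, rfl, hx⟩ := exchange_of_desc ω' t (by
    rw [h', List.map_cons, List.prod_cons, mul_inv_rev, signedSwap_inv, desc_mul_signedSwap]
    exact h)
  have := hω (ω₁ ++ ω₂) (by
    rw [List.map_cons, List.prod_cons, ← inv_mul_eq_iff_eq_mul, signedSwap_inv] at h'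
    rw [← h']
    simp only [List.map_cons, List.map_append, List.prod_cons, List.prod_append]
    rw [← mul_assoc (signedSwap t), hx, mul_assoc, ← mul_assoc (signedSwap x),
      signedSwap_mul_self, one_mul])
  simp at hlt this
  omega

theorem exchange_signedSwap : Exchange (signedSwap (n := n)) := by
  intro ω t hω hn
  apply exchange_of_desc
  by_contra h
  exact hn (isMin_cons_of_not_desc hω h)

theorem alt_signedSwap_ne {x y : Fin n} (hxy : x.val < y.val) {k : ℕ} (hk : 1 ≤ k)
    (hm : k < cox n x y) :
    ((alt x y k).map signedSwap).prod ≠ ((alt y x k).map signedSwap).prod := by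
  have hx := loZ_hiZ x
  have hy := loZ_hiZ y
  have hsx := signedSwap_spec x
  have hsy := signedSwap_spec y
  intro h
  have hc := cox_cases hxy
  have hk3 : k ≤ 3 := by omega
  -- One test point is enough: for lengths below the Coxeter exponent, the two alternating products
  -- differ at `hiZ x`.
  have h1 := congrArg (fun g => g (hiZ x)) h
  interval_cases k
  · simp only [alt, List.map_cons, List.map_nil, List.prod_cons, List.prod_nil, mul_one] at h1
    rw [signedSwap_hiZ] at h1
    have h3 := hsy (hiZ x)
    clear hsx hsy
    rcases hx with hx | hx <;> omega
  · simp only [alt, List.map_cons, List.map_nil, List.prod_cons, List.prod_nil, mul_one,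
      Equiv.Perm.mul_apply] at h1
    rw [signedSwap_hiZ] at h1
    have h3 := hsy (hiZ x)
    have h4 := hsx (hiZ y)
    have h5 := hsy (loZ x)
    clear hsx hsy
    have e1 : signedSwap y (hiZ x) = hiZ y := by omega
    have e2 : signedSwap x (hiZ y) = hiZ y := by clear h3 h5; omega
    rw [e1, e2] at h1
    clear h3 h4
    rcases hc with hc | hc | hc <;> rcases h5 with h5 | h5 | h5 | h5 | h5 <;> omega
  · simp only [alt, List.map_cons, List.map_nil, List.prod_cons, List.prod_nil, mul_one,
      Equiv.Perm.mul_apply] at h1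
    have h0 : x.val = 0 ∧ y.val = 1 := by omega
    rw [show loZ x = -1 by omega, show hiZ x = 1 by omega] at *
    rw [show loZ y = 1 by omega, show hiZ y = 2 by omega] at *
    have e1 : signedSwap x 1 = -1 := by have := hsx 1; omega
    have e2 : signedSwap y (-1) = -2 := by have := hsy (-1); omega
    have e3 : signedSwap x (-2) = -2 := by have := hsx (-2); omega
    have e4 : signedSwap y 1 = 2 := by have := hsy 1; omega
    have e5 : signedSwap x 2 = 2 := by have := hsx 2; omega
    have e6 : signedSwap y 2 = 1 := by have := hsy 2; omega
    rw [e1, e2, e3, e4, e5, e6] at h1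
    omega

/-- Minimal alternating words with equal products occur only at the length of the Coxeter exponent
`m`. Shorter ones have different products. A longer one contains one of length `m + 1`, where the
braid relation produces a repeated letter that cancels. -/
theorem alt_prod_eq {M : Type*} [Monoid M] {f : Fin n → M} (hf : IsBraidFamily f)
    (x y : Fin n) (k : ℕ) (hxy : x ≠ y) (hk : 1 ≤ k) (hmin : IsMin signedSwap (alt x y k))
    (hp : ((alt x y k).map signedSwap).prod = ((alt y x k).map signedSwap).prod) :
    ((alt x y k).map f).prod = ((alt y x k).map f).prod := by
  rcases lt_trichotomy k (cox n x y) with h | h | h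
  · exfalso
    rcases Nat.lt_or_gt_of_ne (Fin.val_ne_of_ne hxy) with h' | h'
    · exact alt_signedSwap_ne h' hk h hp
    · rw [(cox n).symmetric] at h
      exact alt_signedSwap_ne h' hk h hp.symm
  · rw [h]; exact hf.alt_eq hxy
  · exfalso
    obtain ⟨j, rfl⟩ := Nat.exists_eq_add_of_lt h
    obtain ⟨a, b, hab⟩ := alt_add x y (cox n x y + 1) j
    rw [add_right_comm, hab] at hmin
    have hmin := hmin.of_append_left
    have he := isBraidFamily_signedSwap.alt_eq hxy
    obtain ⟨m, hm⟩ : ∃ m, cox n x y = m + 1 := by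
      rw [cox_apply]; split_ifs <;> exact ⟨_, rfl⟩
    rw [hm] at hmin he
    have := hmin (alt y x m) (by
      rw [alt, List.map_cons, List.prod_cons, ← he, alt, List.map_cons, List.prod_cons,
        ← mul_assoc, signedSwap_mul_self, one_mul])
    simp at this

/-- Matsumoto's theorem for the words that are minimal for signed permutations. -/
theorem matsumoto_signed {M : Type*} [Monoid M] {f : Fin n → M} (hf : IsBraidFamily f)
    {ω ω' : List (Fin n)} (hω : IsMin signedSwap ω) (hω' : IsMin signedSwap ω')
    (hp : (ω.map signedSwap).prod = (ω'.map signedSwap).prod) :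
    (ω.map f).prod = (ω'.map f).prod :=
  matsumoto signedSwap_mul_self exchange_signedSwap f (alt_prod_eq hf) hω hω' hp

/-- This is what makes the signed action faithful: words that are minimal for signed permutations
already represent every element of the abstract group. -/
theorem exists_isMin_wordProd (ω : List (Fin n)) :
    ∃ ω', IsMin signedSwap ω' ∧ (cs n).wordProd ω' = (cs n).wordProd ω := by
  induction ω with
  | nil => exact ⟨[], fun _ _ => Nat.zero_le _, rfl⟩
  | cons t ω ih =>
    obtain ⟨ω', hmin, he⟩ := ih
    by_cases h : IsMin signedSwap (t :: ω')
    · exact ⟨t :: ω', h, by rw [CoxeterSystem.wordProd_cons, he, CoxeterSystem.wordProd_cons]⟩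
    · obtain ⟨ω₁, x, ω₂, rfl, hx⟩ := exchange_signedSwap ω' t hmin h
      have hp : ((t :: (ω₁ ++ ω₂)).map signedSwap).prod =
          ((ω₁ ++ x :: ω₂).map signedSwap).prod := by
        simp only [List.map_cons, List.map_append, List.prod_cons, List.prod_append]
        rw [← mul_assoc, hx, mul_assoc]
      have hmin' : IsMin signedSwap (t :: (ω₁ ++ ω₂)) := hmin.congr hp (by simp; omega)
      refine ⟨ω₁ ++ ω₂, hmin'.of_cons, ?_⟩
      -- Matsumoto's theorem with values in `W n` itself turns equality of signed permutations into
      -- equality in the Coxeter group.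
      have hW := matsumoto_signed isBraidFamily_simple hmin' hmin hp
      change (cs n).wordProd _ = (cs n).wordProd _ at hW
      rw [CoxeterSystem.wordProd_cons, ← he, ← hW, CoxeterSystem.wordProd_cons,
        CoxeterSystem.simple_mul_simple_cancel_left]

/-- An element of the kernel has a minimal word with trivial product, and such a word is empty. -/
theorem phi_injective : Function.Injective (phi (n := n)) := by
  rw [injective_iff_map_eq_one]
  intro w hw
  obtain ⟨ω, rfl⟩ := (cs n).wordProd_surjective w
  obtain ⟨ω', hmin, he⟩ := exists_isMin_wordProd ω
  rw [← he, phi_wordProd] at hw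
  have := hmin [] (by rw [hw]; rfl)
  rw [← he, List.length_eq_zero_iff.1 (Nat.le_zero.1 this), CoxeterSystem.wordProd_nil]

theorem isReduced_iff (ω : List (Fin n)) : (cs n).IsReduced ω ↔ IsMin signedSwap ω := by
  rw [CoxeterSystem.IsReduced]
  constructor
  · intro h ω' h'
    rw [← phi_wordProd, ← phi_wordProd] at h'
    rw [← h, ← phi_injective h']
    exact (cs n).length_wordProd_le ω'
  · intro h
    refine le_antisymm ((cs n).length_wordProd_le ω) ?_
    obtain ⟨ω', h1, h2⟩ := (cs n).exists_isReduced ((cs n).wordProd ω)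
    rw [h2, h1]
    apply h
    rw [← phi_wordProd, ← phi_wordProd, h2]

theorem phi_neg (w : W n) (x : ℤ) : phi w (-x) = -phi w x := by
  obtain ⟨ω, rfl⟩ := (cs n).wordProd_surjective w
  rw [phi_wordProd, signedProd_neg]

end Descents

/-! ### The action of `W n` on the strands `0, …, n` -/

section StrandAction

variable {n : ℕ}

/-- The permutation of the strands `0, …, n` attached to a node. -/
def strandSwap (s : Fin n) : Equiv.Perm (Fin (n + 1)) :=
  if s.val = 0 then 1 else Equiv.swap s.castSucc s.succ

theorem strandSwap_val (s : Fin n) (a : Fin (n + 1)) :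
    (s.val = 0 ∧ strandSwap s a = a) ∨ (s.val ≠ 0 ∧ a.val = s.val ∧ (strandSwap s a).val = s.val + 1) ∨
    (s.val ≠ 0 ∧ a.val = s.val + 1 ∧ (strandSwap s a).val = s.val) ∨
    (a.val ≠ s.val ∧ a.val ≠ s.val + 1 ∧ strandSwap s a = a) := by
  unfold strandSwap
  by_cases h : s.val = 0
  · simp [h]
  · rw [if_neg h]
    rcases eq_or_ne a s.castSucc with rfl | h1
    · simp [h]
    · rcases eq_or_ne a s.succ with rfl | h2
      · simp [h]
      · right; right; right
        refine ⟨?_, ?_, Equiv.swap_apply_of_ne_of_ne h1 h2⟩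
        · intro h'; exact h1 (Fin.ext h')
        · intro h'; exact h2 (Fin.ext h')

theorem strandSwap_natAbs (s : Fin n) (a : Fin (n + 1)) (x : ℤ) (h : x.natAbs = a.val) :
    (signedSwap s x).natAbs = (strandSwap s a).val := by
  have h1 := loZ_hiZ s
  have h2 := strandSwap_val s a
  have h3 : strandSwap s a = a → (strandSwap s a).val = a.val := fun h => by rw [h]
  rcases signedSwap_spec s x with h4 | h4 | h4 | h4 | h4 <;> rcases h2 with h2 | h2 | h2 | h2 <;>
  (try have h3 := h3 h2.2) <;> (try have h3 := h3 h2.2.2) <;> omega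

theorem strandProd_natAbs (ω : List (Fin n)) (a : Fin (n + 1)) (x : ℤ) (h : x.natAbs = a.val) :
    ((ω.map signedSwap).prod x).natAbs = ((ω.map strandSwap).prod a).val := by
  induction ω with
  | nil => simpa using h
  | cons s ω ih => simpa using strandSwap_natAbs s _ _ ih

/-- The action on strands is the signed action on absolute values, so it inherits every relation
between words. -/
theorem isBraidFamily_strandSwap : IsBraidFamily (strandSwap (n := n)) := by
  have key : ∀ ω ω' : List (Fin n), (ω.map signedSwap).prod = (ω'.map signedSwap).prod →
      (ω.map strandSwap).prod = (ω'.map strandSwap).prod := by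
    intro ω ω' h
    ext a
    rw [← strandProd_natAbs ω a a.val (by simp), ← strandProd_natAbs ω' a a.val (by simp), h]
  have hσ := isBraidFamily_signedSwap (n := n)
  refine ⟨fun s t h => ?_, fun s t h0 h => ?_, fun s t h0 h => ?_⟩
  · simpa using key [s, t] [t, s] (by simpa using hσ.comm s t h)
  · simpa [mul_assoc] using key [s, t, s] [t, s, t]
      (by simpa [mul_assoc] using hσ.braid s t h0 h)
  · simpa [mul_assoc] using key [s, t, s, t] [t, s, t, s]
      (by simpa [mul_assoc] using hσ.braid₄ s t h0 h)

theorem strandSwap_mul_self (s : Fin n) : strandSwap s * strandSwap s = 1 := by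
  unfold strandSwap
  split_ifs <;> simp

/-- The action of `W_n` on the strands `0, …, n`. -/
noncomputable def tau : W n →* Equiv.Perm (Fin (n + 1)) :=
  (cs n).lift ⟨strandSwap, isBraidFamily_strandSwap.isLiftable strandSwap_mul_self⟩

theorem tau_simple (s : Fin n) : tau ((cs n).simple s) = strandSwap s :=
  (cs n).lift_apply_simple _ s

theorem tau_wordProd (ω : List (Fin n)) : tau ((cs n).wordProd ω) = (ω.map strandSwap).prod := by
  induction ω with
  | nil => simp
  | cons s ω ih =>
    rw [CoxeterSystem.wordProd_cons, map_mul, tau_simple, ih, List.map_cons, List.prod_cons]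

theorem tau_val (w : W n) (a : Fin (n + 1)) : (tau w a).val = (phi w a.val).natAbs := by
  obtain ⟨ω, rfl⟩ := (cs n).wordProd_surjective w
  rw [tau_wordProd, phi_wordProd, strandProd_natAbs ω a a.val (by simp)]

theorem phi_zero (w : W n) : phi w 0 = 0 := by
  have := phi_neg w 0
  simp at this
  omega

theorem tau_of_rootPair {w : W n} {s t : Fin n} (h : RootPair (phi w) s t) :
    (tau w t.castSucc = s.castSucc ∧ tau w t.succ = s.succ) ∨
    (tau w t.castSucc = s.succ ∧ tau w t.succ = s.castSucc) := by
  have h0 := h.zero_iff (phi_neg w)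
  have h1 := tau_val w t.castSucc
  have h2 := tau_val w t.succ
  have ht := loZ_hiZ t
  have hs := loZ_hiZ s
  have h3 := phi_zero w
  have e2 : ((t.succ.val : ℕ) : ℤ) = hiZ t := by simp [hiZ]
  rw [e2] at h2
  simp only [Fin.ext_iff, Fin.val_castSucc, Fin.val_succ] at *
  -- The strands of a node are its two integers, except that the node `0` has the strands `0, 1` but
  -- the integers `-1, 1`. Therefore it is treated apart.
  by_cases htz : t.val = 0
  · rw [htz] at h1
    simp only [Nat.cast_zero, h3] at h1
    rcases h with h | h | h | h <;> omega
  · rw [show ((t.val : ℕ) : ℤ) = loZ t by omega] at h1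
    rcases h with h | h | h | h <;> omega

end StrandAction

/-! ### The order of `W n` -/

section Card

variable {n : ℕ}

/-- The change of sign at `1` is the node `0`; conjugation by the swap of `j + 1` and `j + 2`
carries the change of sign from one integer to the next. -/
theorem exists_signFlip (j : ℕ) (hj : j < n) : ∃ d : W n, ∀ x : ℤ,
    phi d x = if x = j + 1 ∨ x = -(j + 1) then -x else x := by
  induction j with
  | zero =>
    refine ⟨(cs n).simple ⟨0, hj⟩, fun x => ?_⟩
    rw [phi_simple]
    have h1 := loZ_hiZ (⟨0, hj⟩ : Fin n)
    have h2 := signedSwap_spec (⟨0, hj⟩ : Fin n) x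
    simp only at h1
    split_ifs <;> omega
  | succ j ih =>
    obtain ⟨d, hd⟩ := ih (by omega)
    refine ⟨(cs n).simple ⟨j + 1, hj⟩ * d * (cs n).simple ⟨j + 1, hj⟩, fun x => ?_⟩
    rw [map_mul, map_mul, phi_simple, Equiv.Perm.mul_apply, Equiv.Perm.mul_apply, hd]
    have h1 := loZ_hiZ (⟨j + 1, hj⟩ : Fin n)
    have h2 := signedSwap_spec (⟨j + 1, hj⟩ : Fin n)
    simp only at h1
    rw [show loZ (⟨j + 1, hj⟩ : Fin n) = j + 1 by omega,
      show hiZ (⟨j + 1, hj⟩ : Fin n) = j + 2 by omega] at h2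
    have h3 := h2 x
    have h4 := h2 (signedSwap (⟨j + 1, hj⟩ : Fin n) x)
    have h5 := h2 (-signedSwap (⟨j + 1, hj⟩ : Fin n) x)
    clear h1 h2 hd
    push_cast
    split_ifs <;> rcases h3 with h3 | h3 | h3 | h3 | h3 <;> omega

theorem exists_tau_succ (e : Equiv.Perm (Fin n)) :
    ∃ w : W n, ∀ j : Fin n, tau w j.succ = (e j).succ := by
  rcases n with _ | m
  · exact ⟨1, fun j => j.elim0⟩
  have : e ∈ Submonoid.closure (Set.range fun i : Fin m => Equiv.swap i.castSucc i.succ) := by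
    rw [Equiv.Perm.mclosure_swap_castSucc_succ]; trivial
  induction this using Submonoid.closure_induction with
  | mem e he =>
    obtain ⟨i, rfl⟩ := he
    refine ⟨(cs _).simple i.succ, fun j => ?_⟩
    rw [tau_simple, strandSwap, if_neg (by simp)]
    have : (i.succ.castSucc : Fin (m + 2)) = i.castSucc.succ := rfl
    rw [this, (Fin.succ_injective _).swap_apply]
  | one => exact ⟨1, fun j => by simp⟩
  | mul e e' _ _ h h' =>
    obtain ⟨w, hw⟩ := h
    obtain ⟨w', hw'⟩ := h'
    exact ⟨w * w', fun j => by rw [map_mul, Equiv.Perm.mul_apply, hw', hw]; rfl⟩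

theorem exists_tau_sign (e : Equiv.Perm (Fin n)) (ε : Fin n → Bool) :
    ∃ w : W n, ∀ j : Fin n, tau w j.succ = (e j).succ ∧ (phi w (j.val + 1) < 0 ↔ ε j = true) := by
  -- The signs are corrected one strand at a time: multiplication on the right by a sign change
  -- alters one sign and no absolute value.
  have key : ∀ S : Finset (Fin n), ∃ w : W n, ∀ j : Fin n, tau w j.succ = (e j).succ ∧
      (j ∈ S → (phi w (j.val + 1) < 0 ↔ ε j = true)) := by
    intro S
    induction S using Finset.induction_on with
    | empty =>
      obtain ⟨w, hw⟩ := exists_tau_succ e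
      exact ⟨w, fun j => ⟨hw j, by simp⟩⟩
    | insert i S hi ih =>
      obtain ⟨w, hw⟩ := ih
      by_cases h : (phi w (i.val + 1) < 0 ↔ ε i = true)
      · refine ⟨w, fun j => ⟨(hw j).1, fun hj => ?_⟩⟩
        rcases Finset.mem_insert.1 hj with rfl | hj
        · exact h
        · exact (hw j).2 hj
      · obtain ⟨d, hd⟩ := exists_signFlip i.val i.isLt
        have hne : phi w (i.val + 1) ≠ phi w 0 := (phi w).injective.ne (by omega)
        rw [phi_zero] at hne
        have h1 : ∀ j : Fin n, j ≠ i → phi (w * d) (j.val + 1) = phi w (j.val + 1) := by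
          intro j hj
          have := Fin.val_ne_of_ne hj
          rw [map_mul, Equiv.Perm.mul_apply, hd, if_neg (by omega)]
        have h2 : phi (w * d) (i.val + 1) = -phi w (i.val + 1) := by
          rw [map_mul, Equiv.Perm.mul_apply, hd, if_pos (by simp), phi_neg]
        refine ⟨w * d, fun j => ⟨?_, fun hj => ?_⟩⟩
        · rw [← (hw j).1]
          apply Fin.ext
          rw [tau_val, tau_val, Fin.val_succ]
          push_cast
          by_cases hj : j = i
          · subst hj; rw [h2, Int.natAbs_neg]
          · rw [h1 j hj]
        · by_cases hji : j = i
          · subst hji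
            rw [h2]
            constructor
            · intro h3
              by_contra h4
              exact h ⟨fun _ => by omega, fun h5 => absurd h5 h4⟩
            · intro h3
              by_contra h4
              exact h ⟨fun _ => h3, fun _ => by omega⟩
          · rw [h1 j hji]
            exact (hw j).2 ((Finset.mem_insert.1 hj).resolve_left hji)
  obtain ⟨w, hw⟩ := key Finset.univ
  exact ⟨w, fun j => ⟨(hw j).1, (hw j).2 (Finset.mem_univ j)⟩⟩

theorem phi_of_lt (w : W n) {x : ℤ} (hx : (n : ℤ) < x) : phi w x = x := by
  obtain ⟨ω, rfl⟩ := (cs n).wordProd_surjective w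
  rw [phi_wordProd]
  induction ω with
  | nil => simp
  | cons s ω ih =>
    have h1 := loZ_hiZ s
    have h2 := signedSwap_spec s x
    simp only [List.map_cons, List.prod_cons, Equiv.Perm.mul_apply, ih]
    omega

theorem eq_of_tau_sign {w w' : W n} (h : ∀ j : Fin n, tau w j.succ = tau w' j.succ)
    (h' : ∀ j : Fin n, phi w (j.val + 1) < 0 ↔ phi w' (j.val + 1) < 0) : w = w' := by
  apply phi_injective
  have hpos : ∀ x : ℤ, 0 < x → phi w x = phi w' x := by
    intro x hx
    by_cases hn : (n : ℤ) < x
    · rw [phi_of_lt w hn, phi_of_lt w' hn]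
    · have hj : x.toNat - 1 < n := by omega
      have h1 := congrArg Fin.val (h ⟨x.toNat - 1, hj⟩)
      have h2 := h' ⟨x.toNat - 1, hj⟩
      have e : ((x.toNat - 1 : ℕ) : ℤ) + 1 = x := by omega
      rw [tau_val, tau_val, Fin.val_succ] at h1
      push_cast at h1
      simp only [e] at h1 h2
      omega
  ext x
  rcases lt_trichotomy x 0 with hx | rfl | hx
  · have := hpos (-x) (by omega)
    rw [phi_neg, phi_neg] at this
    omega
  · rw [phi_zero, phi_zero]
  · exact hpos x hx

theorem tau_zero (w : W n) : tau w 0 = 0 := by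
  apply Fin.ext
  rw [tau_val]
  simp [phi_zero]

/-- A signed permutation is determined by its signs and its underlying permutation. -/
noncomputable def signPerm (w : W n) : (Fin n → Bool) × Equiv.Perm (Fin n) :=
  (fun j => decide (phi w (j.val + 1) < 0), (Equiv.Perm.decomposeFin (tau w)).2)

theorem signPerm_snd (w : W n) (j : Fin n) : ((signPerm w).2 j).succ = tau w j.succ := by
  have h1 : Equiv.Perm.decomposeFin.symm (Equiv.Perm.decomposeFin (tau w)) = tau w :=
    Equiv.symm_apply_apply _ _
  have h2 : (Equiv.Perm.decomposeFin (tau w)).1 = 0 := by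
    rw [← tau_zero w]
    conv_rhs => rw [← h1]
    rw [← Prod.mk.eta (p := Equiv.Perm.decomposeFin (tau w)),
      Equiv.Perm.decomposeFin_symm_apply_zero]
  conv_rhs => rw [← h1]
  rw [← Prod.mk.eta (p := Equiv.Perm.decomposeFin (tau w)),
    Equiv.Perm.decomposeFin_symm_apply_succ, h2]
  simp [signPerm]

theorem signPerm_bijective : Function.Bijective (signPerm (n := n)) := by
  constructor
  · intro w w' h
    apply eq_of_tau_sign
    · intro j
      rw [← signPerm_snd, ← signPerm_snd, h]
    · intro j
      have := congrFun (congrArg Prod.fst h) j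
      simpa [signPerm] using this
  · rintro ⟨ε, e⟩
    obtain ⟨w, hw⟩ := exists_tau_sign e ε
    refine ⟨w, Prod.ext ?_ ?_⟩
    · funext j
      rw [signPerm, Bool.eq_iff_iff, decide_eq_true_iff]
      exact (hw j).2
    · ext j
      have := signPerm_snd w j
      rw [(hw j).1] at this
      rw [Fin.succ_injective _ this]

theorem card_W : Nat.card (W n) = 2 ^ n * n.factorial := by
  rw [Nat.card_congr (Equiv.ofBijective _ signPerm_bijective)]
  simp [Fintype.card_perm]

end Card

/-! ### Equivalence relations are counted by Bell numbers -/

section Bell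

open Classical in
/-- Equivalence relations on `Option α` for which `s` is the complement of the class of `none`
correspond to equivalence relations on `s`. -/
noncomputable def setoidOptionEquiv {α : Type*} (s : Set α) :
    {r : Setoid (Option α) // {a | ¬ r (some a) none} = s} ≃ Setoid s where
  toFun r := r.1.comap fun a : s => some a.1
  invFun r :=
    let f : Option α → Option (Quotient r) := fun x =>
      x.bind fun a => if h : a ∈ s then some (Quotient.mk r ⟨a, h⟩) else none
    ⟨Setoid.ker f, by
      ext a
      by_cases h : a ∈ s <;> simp [Setoid.ker_def, f, h]⟩
  left_inv := by
    rintro ⟨r, rfl⟩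
    apply Subtype.ext
    ext x y
    have hq : ∀ (a b : {a | ¬ r (some a) none}),
        (Quotient.mk (r.comap fun a : {a | ¬ r (some a) none} => some a.1) a =
          Quotient.mk (r.comap fun a : {a | ¬ r (some a) none} => some a.1) b) ↔
        r (some a.1) (some b.1) := fun a b => Quotient.eq
    rcases x with _ | a <;> rcases y with _ | b
    · simp
    · by_cases h : r (some b) none
      · simpa [Setoid.ker_def, h] using r.symm' h
      · simpa [Setoid.ker_def, h] using fun h' => h (r.symm' h')
    · by_cases h : r (some a) none <;> simp [Setoid.ker_def, h]
    · by_cases h : r (some a) none <;> by_cases h' : r (some b) none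
      · simpa [Setoid.ker_def, h, h'] using r.trans' h (r.symm' h')
      · simpa [Setoid.ker_def, h, h'] using fun h'' => h' (r.trans' (r.symm' h'') h)
      · simpa [Setoid.ker_def, h, h'] using fun h'' => h (r.trans' h'' h')
      · simp [Setoid.ker_def, h, h', hq]
  right_inv r := by
    ext a b
    simp only [Setoid.comap_rel, Setoid.ker_def, Option.bind_some, Subtype.coe_prop, dite_true,
      Subtype.coe_eta, Option.some_inj]
    exact Quotient.eq

instance finite_setoid {α : Type*} [Finite α] : Finite (Setoid α) :=
  Finite.of_injective (fun r : Setoid α => fun a b => r a b) fun _ _ h =>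
    Setoid.ext fun a b => iff_of_eq (congrFun (congrFun h a) b)

/-- Relations are sorted by the set of points not equivalent to the added point `none`; what remains
to choose is a relation on that set. This is the Bell recurrence. -/
theorem card_setoid_option (α : Type*) [Finite α] :
    Nat.card (Setoid (Option α)) = ∑ᶠ s : Set α, Nat.card (Setoid s) := by
  classical
  rw [Nat.card_congr (Equiv.sigmaFiberEquiv
    fun r : Setoid (Option α) => {a | ¬ r (some a) none}).symm]
  have := Fintype.ofFinite (Set α)
  rw [Nat.card_sigma, finsum_eq_sum_of_fintype]
  exact Finset.sum_congr rfl fun s _ => Nat.card_congr (setoidOptionEquiv s)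

/-- The equivalence relations on a type with `n` elements are counted by the Bell number. -/
theorem card_setoid (α : Type) [Finite α] : Nat.card (Setoid α) = (Nat.card α).bell := by
  suffices h : ∀ n (α : Type) [Finite α], Nat.card α = n → Nat.card (Setoid α) = n.bell from
    h _ α rfl
  intro n
  induction n using Nat.strong_induction_on with
  | _ n ih =>
    intro α _ hα
    rcases n with _ | n
    · have := (Nat.card_eq_zero.1 hα).resolve_right (not_infinite_iff_finite.2 inferInstance)
      rw [Nat.bell_zero, Nat.card_eq_one_iff_unique]
      exact ⟨⟨fun a b => Setoid.ext fun x => isEmptyElim x⟩, ⟨⊥⟩⟩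
    · have e : α ≃ Option (Fin n) := (Finite.equivFinOfCardEq hα).trans (finSuccEquiv n)
      have e' : Setoid α ≃ Setoid (Option (Fin n)) :=
        { toFun := fun r => r.comap e.symm
          invFun := fun r => r.comap e
          left_inv := fun r => Setoid.ext fun a b => by simp [Setoid.comap_rel]
          right_inv := fun r => Setoid.ext fun a b => by simp [Setoid.comap_rel] }
      rw [Nat.card_congr e', card_setoid_option, finsum_eq_sum_of_fintype, Nat.bell_succ]
      classical
      rw [← Fintype.sum_equiv (Fintype.finsetEquivSet (α := Fin n))
        (fun s => Nat.bell s.card) _ (fun s => ?_)]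
      -- Grouping by the size of the set gives the summands in the order opposite to that of
      -- `Nat.bell_succ`, hence the reflection `k ↦ n - k`.
      · rw [← Finset.powerset_univ, Finset.sum_powerset_apply_card (fun k => Nat.bell k),
          Finset.card_univ, Fintype.card_fin, ← Nat.range_succ_eq_Iic, ← Finset.sum_range_reflect]
        refine Finset.sum_congr rfl fun k hk => ?_
        have hk := Finset.mem_range.1 hk
        rw [smul_eq_mul, show n + 1 - 1 - k = n - k by omega, Nat.choose_symm (by omega)]
      · have hs : Nat.card (Fintype.finsetEquivSet s : Set (Fin n)) = s.card := by simp
        have := s.card_le_univ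
        rw [Fintype.card_fin] at this
        exact (ih s.card (by omega) _ hs).symm

end Bell

/-! ### Set partitions as equivalence relations -/

section Partitions

variable {n : ℕ}

/-- The equivalence relation of a set partition. -/
noncomputable def partSetoid (I : SetPart n) : Setoid (Fin (n + 1)) := Setoid.ker I.part

theorem partSetoid_iff (I : SetPart n) (a b : Fin (n + 1)) :
    partSetoid I a b ↔ b ∈ I.part a := by
  rw [partSetoid, Setoid.ker_def, eq_comm,
    I.mem_part_iff_part_eq_part (Finset.mem_univ _) (Finset.mem_univ _)]

theorem partSetoid_bijective : Function.Bijective (partSetoid (n := n)) := by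
  classical
  constructor
  · intro I J h
    have hp : ∀ a, I.part a = J.part a := fun a => by
      ext b
      rw [← partSetoid_iff, ← partSetoid_iff, h]
    apply Finpartition.ext
    ext t
    constructor
    · intro ht
      obtain ⟨a, ha⟩ := I.nonempty_of_mem_parts ht
      rw [← I.part_eq_of_mem ht ha, hp]
      exact J.part_mem.2 (Finset.mem_univ _)
    · intro ht
      obtain ⟨a, ha⟩ := J.nonempty_of_mem_parts ht
      rw [← J.part_eq_of_mem ht ha, ← hp]
      exact I.part_mem.2 (Finset.mem_univ _)
  · intro r
    refine ⟨Finpartition.ofSetoid r, Setoid.ext fun a b => ?_⟩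
    rw [partSetoid_iff, Finpartition.mem_part_ofSetoid_iff_rel]

end Partitions

/-! ### Commuting idempotents indexed by pairs, and their products over equivalence relations -/

section PartitionFamily

variable {α R : Type*} [Monoid R]

/-- A family of commuting idempotents indexed by pairs that satisfies the relations of the
lattice of equivalence relations. -/
structure IsPartitionFamily (x : α → α → R) : Prop where
  refl : ∀ a, x a a = 1
  symm : ∀ a b, x a b = x b a
  comm : ∀ a b c d, x a b * x c d = x c d * x a b
  idem : ∀ a b, x a b * x a b = x a b
  trans : ∀ a b c, x a b * x b c = x a b * x a c

theorem mul_list_prod_of_mem {L : List R} {y : R} (hL : ∀ z ∈ L, y * z = z * y) (hy : y ∈ L)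
    (h : y * y = y) : y * L.prod = L.prod := by
  induction L with
  | nil => simp at hy
  | cons z L ih =>
    rcases List.mem_cons.1 hy with rfl | hy
    · rw [List.prod_cons, ← mul_assoc, h]
    · rw [List.prod_cons, ← mul_assoc, hL z (by simp), mul_assoc,
        ih (fun w hw => hL w (by simp [hw])) hy]

theorem list_prod_mul_eq {L : List R} {z : R} (h : ∀ y ∈ L, y * z = z) : L.prod * z = z := by
  induction L with
  | nil => simp
  | cons y L ih =>
    rw [List.prod_cons, mul_assoc, ih fun w hw => h w (by simp [hw]), h y (by simp)]

theorem mul_list_prod_eq {L : List R} {z : R} (h : ∀ y ∈ L, z * y = z) : z * L.prod = z := by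
  induction L with
  | nil => simp
  | cons y L ih =>
    rw [List.prod_cons, ← mul_assoc, h y (by simp), ih fun w hw => h w (by simp [hw])]

open Classical in
/-- The product of the members of a family over all pairs of equivalent elements. -/
noncomputable def partProd [Fintype α] (x : α → α → R) (r : Setoid α) : R :=
  (((Finset.univ : Finset (α × α)).toList.filter fun p => r p.1 p.2).map
    fun p => x p.1 p.2).prod

/-- The equivalence relation generated by one pair. -/
def pairSetoid (a b : α) : Setoid α := Relation.EqvGen.setoid fun c d => c = a ∧ d = b

theorem pairSetoid_le {a b : α} {r : Setoid α} : pairSetoid a b ≤ r ↔ r a b := by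
  constructor
  · intro h
    exact h (Relation.EqvGen.rel _ _ ⟨rfl, rfl⟩)
  · intro h
    refine Setoid.eqvGen_le fun c d => ?_
    rintro ⟨rfl, rfl⟩
    exact h

variable {x : α → α → R} (hx : IsPartitionFamily x)
include hx

/-- The pairs whose member of the family fixes `z` form an equivalence relation. -/
def IsPartitionFamily.fixSetoid (z : R) : Setoid α where
  r a b := x a b * z = z
  iseqv := by
    refine ⟨fun a => by rw [hx.refl, one_mul], fun {a b} h => by rw [hx.symm, h],
      fun {a b c} h h' => ?_⟩
    calc x a c * z = x a c * (x a b * z) := by rw [h]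
      _ = x a b * x b c * z := by rw [← mul_assoc, hx.comm, hx.trans]
      _ = z := by rw [mul_assoc, h', h]

theorem IsPartitionFamily.fixSetoid_iff (z : R) (a b : α) :
    hx.fixSetoid z a b ↔ x a b * z = z := Iff.rfl

variable [Fintype α]

theorem IsPartitionFamily.mul_partProd {r : Setoid α} {a b : α} (h : r a b) :
    x a b * partProd x r = partProd x r := by
  apply mul_list_prod_of_mem
  · intro z hz
    obtain ⟨p, -, rfl⟩ := List.mem_map.1 hz
    exact hx.comm _ _ _ _
  · exact List.mem_map.2 ⟨(a, b), by simpa using h, rfl⟩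
  · exact hx.idem _ _

theorem IsPartitionFamily.comm_partProd (r : Setoid α) (a b : α) :
    x a b * partProd x r = partProd x r * x a b := by
  refine Commute.list_prod_right _ _ fun z hz => ?_
  obtain ⟨p, -, rfl⟩ := List.mem_map.1 hz
  exact hx.comm _ _ _ _

theorem IsPartitionFamily.partProd_mul {r : Setoid α} {a b : α} (h : r a b) :
    partProd x r * x a b = partProd x r := by
  rw [← hx.comm_partProd, hx.mul_partProd h]

theorem IsPartitionFamily.partProd_mul_of_le {r : Setoid α} {z : R} (h : r ≤ hx.fixSetoid z) :
    partProd x r * z = z := by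
  apply list_prod_mul_eq
  intro y hy
  obtain ⟨p, hp, rfl⟩ := List.mem_map.1 hy
  exact h (by simpa using hp)

/-- Two elements that absorb each other are equal. Since the pairs that fix `z` form an equivalence
relation, the first hypothesis has to be tested only on pairs that generate `r`. -/
theorem IsPartitionFamily.eq_partProd {r : Setoid α} {z : R} (h : r ≤ hx.fixSetoid z)
    (h' : partProd x r * z = partProd x r) : z = partProd x r := by
  rw [← h', hx.partProd_mul_of_le h]

theorem IsPartitionFamily.partProd_mul_partProd_of_le {r r' : Setoid α} (h : r' ≤ r) :
    partProd x r * partProd x r' = partProd x r := by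
  apply mul_list_prod_eq
  intro y hy
  obtain ⟨p, hp, rfl⟩ := List.mem_map.1 hy
  exact hx.partProd_mul (h (by simpa using hp))

theorem IsPartitionFamily.partProd_sup (r r' : Setoid α) :
    partProd x r * partProd x r' = partProd x (r ⊔ r') := by
  apply hx.eq_partProd
  · refine sup_le ?_ ?_
    · intro a b h
      rw [hx.fixSetoid_iff, ← mul_assoc, hx.mul_partProd h]
    · intro a b h
      rw [hx.fixSetoid_iff, ← mul_assoc, hx.comm_partProd, mul_assoc, hx.mul_partProd h]
  · rw [← mul_assoc, hx.partProd_mul_partProd_of_le le_sup_left,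
      hx.partProd_mul_partProd_of_le le_sup_right]

theorem IsPartitionFamily.partProd_pair (a b : α) : partProd x (pairSetoid a b) = x a b := by
  refine (hx.eq_partProd ?_ ?_).symm
  · rw [pairSetoid_le, hx.fixSetoid_iff, hx.idem]
  · exact hx.partProd_mul (pairSetoid_le.1 le_rfl)

theorem IsPartitionFamily.partProd_bot : partProd x ⊥ = 1 := by
  refine (hx.eq_partProd bot_le ?_).symm
  rw [mul_one]

end PartitionFamily

/-! ### How conjugation moves the elements `E_{a,b}` -/

section ConjugationFamily

/-- The transforms `C_a C_{a+1} ⋯ C_{a+k-1} e_{a+k}`. -/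
def strandPair {α : Type*} (C : ℕ → Equiv.Perm α) (e : ℕ → α) (a : ℕ) : ℕ → α
  | 0 => e a
  | k + 1 => C a (strandPair C e (a + 1) k)

/-- Braid-like relations between bijections `C_i` and elements `e_i` for `i < m`. -/
structure IsTiedFamily {α : Type*} (m : ℕ) (C : ℕ → Equiv.Perm α) (e : ℕ → α) : Prop where
  comm : ∀ i j x, i + 1 < j → j < m → C i (C j x) = C j (C i x)
  braid : ∀ i x, i + 1 < m → C i (C (i + 1) (C i x)) = C (i + 1) (C i (C (i + 1) x))
  self : ∀ i, i < m → C i (e i) = e i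
  far : ∀ i j, i < m → j < m → (i + 1 < j ∨ j + 1 < i) → C i (e j) = e j
  near : ∀ i, i + 1 < m → C (i + 1) (C i (e (i + 1))) = e i
  sq_up : ∀ i, i + 1 < m → C i (C i (e (i + 1))) = e (i + 1)
  sq_down : ∀ i, i + 1 < m → C (i + 1) (C (i + 1) (e i)) = e i

variable {α : Type*} {m : ℕ} {C : ℕ → Equiv.Perm α} {e : ℕ → α} (h : IsTiedFamily m C e)
include h

theorem IsTiedFamily.strandPair_far {i a k : ℕ} (hi : i < m) (hk : a + k < m)
    (hfar : i + 1 < a ∨ a + k + 1 < i) : C i (strandPair C e a k) = strandPair C e a k := by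
  induction k generalizing a with
  | zero => exact h.far i a hi (by omega) (by omega)
  | succ k ih =>
    rw [strandPair]
    rcases hfar with hfar | hfar
    · rw [h.comm i a _ hfar (by omega), ih (by omega) (by omega)]
    · rw [← h.comm a i _ (by omega) hi, ih (by omega) (by omega)]

theorem IsTiedFamily.strandPair_down {a k : ℕ} (hk : a + k + 1 < m) :
    C (a + k + 1) (strandPair C e a (k + 1)) = strandPair C e a k := by
  induction k generalizing a with
  | zero => exact h.near a hk
  | succ k ih =>
    rw [strandPair, ← h.comm a _ _ (by omega) (by omega),
      show a + (k + 1) + 1 = (a + 1) + k + 1 by omega, ih (by omega), strandPair]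

theorem IsTiedFamily.strandPair_up {a k : ℕ} (hk : a + k + 1 < m) :
    C (a + k + 1) (strandPair C e a k) = strandPair C e a (k + 1) := by
  induction k generalizing a with
  | zero =>
    rw [strandPair, ← (C (a + 1)).injective.eq_iff, add_zero, h.sq_down a hk, strandPair, strandPair]
    exact (h.near a hk).symm
  | succ k ih =>
    rw [strandPair, ← h.comm a _ _ (by omega) (by omega),
      show a + (k + 1) + 1 = (a + 1) + k + 1 by omega, ih (by omega)]
    rfl

/-- `C_a` applied twice fixes `e_{a+1}`. Longer elements arise from it on the right, through
bijections that commute with `C_a`. -/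
theorem IsTiedFamily.strandPair_start {a k : ℕ} (hk : a + k + 1 < m) :
    C a (strandPair C e a (k + 1)) = strandPair C e (a + 1) k := by
  rw [strandPair]
  induction k with
  | zero => exact h.sq_up a hk
  | succ k ih =>
    rw [← h.strandPair_up (a := a + 1) (k := k) (by omega),
      h.comm a (a + 1 + k + 1) _ (by omega) (by omega),
      h.comm a (a + 1 + k + 1) _ (by omega) (by omega), ih (by omega)]

/-- Bijections far from `i` are passed until `i = a + 1`. There `C_{a+1} C_a C_{a+1} = C_a C_{a+1}
C_a`, and the innermost `C_a` fixes the remaining element, which starts at `a + 2`. -/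
theorem IsTiedFamily.strandPair_mid {i a k : ℕ} (hk : a + k < m) (hi : a < i) (hik : i < a + k) :
    C i (strandPair C e a k) = strandPair C e a k := by
  induction k generalizing a with
  | zero => omega
  | succ k ih =>
    rcases Nat.lt_or_ge (a + 1) i with h' | h'
    · rw [strandPair, ← h.comm a i _ h' (by omega), ih (by omega) h' (by omega)]
    · obtain rfl : i = a + 1 := by omega
      obtain ⟨k, rfl⟩ : ∃ l, k = l + 1 := ⟨k - 1, by omega⟩
      rw [strandPair, strandPair, ← h.braid a _ (by omega),
        h.strandPair_far (by omega) (by omega) (by omega)]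

/-- The bijection `C_i` permutes the elements `E_{a,b}` like the transposition `(i, i + 1)`. -/
theorem IsTiedFamily.strandPair_swap {i a b : ℕ} (hi : i < m) (hab : a < b) (hb : b ≤ m) :
    C i (strandPair C e a (b - a - 1)) =
      if i = a then if b = a + 1 then strandPair C e a (b - a - 1)
        else strandPair C e (a + 1) (b - (a + 1) - 1)
      else if i + 1 = a then strandPair C e i (b - i - 1)
      else if i = b then strandPair C e a (b + 1 - a - 1)
      else if i + 1 = b then strandPair C e a (i - a - 1)
      else strandPair C e a (b - a - 1) := by
  obtain ⟨k, rfl⟩ : ∃ k, b = a + k + 1 := ⟨b - a - 1, by omega⟩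
  rw [show a + k + 1 - a - 1 = k by omega]
  split_ifs with h1 h2 h3 h4 h5
  · obtain rfl : k = 0 := by omega
    subst h1
    exact h.self i hi
  · obtain ⟨l, rfl⟩ : ∃ l, k = l + 1 := ⟨k - 1, by omega⟩
    subst h1
    rw [h.strandPair_start (by omega)]
    congr 1
    omega
  · subst h3
    rw [show i + 1 + k + 1 - i - 1 = k + 1 by omega, strandPair]
  · subst h4
    rw [h.strandPair_up (by omega)]
    congr 1
    omega
  · obtain ⟨l, rfl⟩ : ∃ l, k = l + 1 := ⟨k - 1, by omega⟩
    obtain rfl : i = a + l + 1 := by omega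
    rw [h.strandPair_down (by omega)]
    congr 1
    omega
  · rcases Nat.lt_or_ge i a with h' | h'
    · exact h.strandPair_far hi (by omega) (by omega)
    · rcases Nat.lt_or_ge i (a + k) with h'' | h''
      · exact h.strandPair_mid (by omega) (by omega) h''
      · exact h.strandPair_far hi (by omega) (by omega)

end ConjugationFamily

/-! ### The defining relations in the algebra -/

section AlgebraRelations

variable {n : ℕ}

theorem proj_rel {x y : FreeAlgebra K (Gen n)} (h : Rel n x y) : proj n x = proj n y :=
  RingQuot.mkAlgHom_rel K h

theorem T_comm {i j : Fin (n - 1)} (h : Far i j) : T i * T j = T j * T i := by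
  simpa only [T, map_mul] using proj_rel (Rel.t_comm i j h)

theorem T_braid {i j : Fin (n - 1)} (h : i.val + 1 = j.val) :
    T i * T j * T i = T j * T i * T j := by
  simpa only [T, map_mul] using proj_rel (Rel.t_braid i j h)

theorem E_sq (i : Fin (n - 1)) : E i * E i = E i := by
  simpa only [E, map_mul] using proj_rel (Rel.e_sq i)

theorem E_comm (i j : Fin (n - 1)) : E i * E j = E j * E i := by
  simpa only [E, map_mul] using proj_rel (Rel.e_comm i j)

theorem E_T_far {i j : Fin (n - 1)} (h : Far i j) : E i * T j = T j * E i := by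
  simpa only [E, T, map_mul] using proj_rel (Rel.e_t_far i j h)

theorem E_E_T {i j : Fin (n - 1)} (h : Near i j) : E i * E j * T i = T i * E i * E j := by
  simpa only [E, T, map_mul] using proj_rel (Rel.e_e_t i j h)

theorem E_T_T {i j : Fin (n - 1)} (h : Near i j) : E i * T j * T i = T j * T i * E j := by
  simpa only [E, T, map_mul] using proj_rel (Rel.e_t_t i j h)

theorem B_T_braid {i : Fin (n - 1)} (h : i.val = 0) : B * T i * B * T i = T i * B * T i * B := by
  simpa only [B, T, map_mul] using proj_rel (Rel.b_t_braid i h)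

theorem B_T_comm {i : Fin (n - 1)} (h : i.val ≠ 0) : B * T i = T i * B := by
  simpa only [B, T, map_mul] using proj_rel (Rel.b_t_comm i h)

theorem B_sq {j : Fin n} (h : j.val = 0) : B * B = 1 + (v - v⁻¹) • (F j * B) := by
  simpa only [B, F, map_mul, map_add, map_one, map_smul] using proj_rel (Rel.b_sq j h)

theorem B_E (i : Fin (n - 1)) : B * E i = E i * B := by
  simpa only [B, E, map_mul] using proj_rel (Rel.b_e i)

theorem F_sq (j : Fin n) : F j * F j = F j := by
  simpa only [F, map_mul] using proj_rel (Rel.f_sq j)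

theorem B_F (j : Fin n) : B * F j = F j * B := by
  simpa only [B, F, map_mul] using proj_rel (Rel.b_f j)

theorem F_E (j : Fin n) (i : Fin (n - 1)) : F j * E i = E i * F j := by
  simpa only [E, F, map_mul] using proj_rel (Rel.f_e j i)

theorem F_T (j : Fin n) (i : Fin (n - 1)) : F j * T i = T i * F (Equiv.swap (lo i) (hi i) j) := by
  simpa only [T, F, map_mul] using proj_rel (Rel.f_t j i)

theorem E_F_lo (i : Fin (n - 1)) : E i * F (lo i) = F (lo i) * F (hi i) := by
  simpa only [E, F, map_mul] using proj_rel (Rel.e_f_lo i)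

theorem E_F_hi (i : Fin (n - 1)) : F (lo i) * F (hi i) = E i * F (hi i) := by
  simpa only [E, F, map_mul] using proj_rel (Rel.e_f_hi i)

end AlgebraRelations

/-! ### Conjugation by `T_i` permutes the `E_{a,b}` -/

section ConjT

variable {n : ℕ}

/-- Conjugation by a unit, as a permutation. -/
def conjPerm {R : Type*} [Monoid R] (U : Rˣ) : Equiv.Perm R where
  toFun x := U * x * (U⁻¹ : Rˣ)
  invFun x := (U⁻¹ : Rˣ) * x * U
  left_inv x := by simp [mul_assoc]
  right_inv x := by simp [mul_assoc]

theorem conjPerm_apply {R : Type*} [Monoid R] (U : Rˣ) (x : R) :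
    conjPerm U x = U * x * (U⁻¹ : Rˣ) := rfl

theorem conjPerm_mul {R : Type*} [Monoid R] (U V : Rˣ) (x : R) :
    conjPerm (U * V) x = conjPerm U (conjPerm V x) := by
  simp [conjPerm_apply, mul_assoc]

theorem conjPerm_eq_iff {R : Type*} [Monoid R] (U : Rˣ) (x y : R) :
    conjPerm U x = y ↔ U * x = y * U := by
  rw [conjPerm_apply, Units.mul_inv_eq_iff_eq_mul]

/-- Conjugation by `T_i`. -/
noncomputable def conjT (n i : ℕ) : Equiv.Perm (BtAlg n) :=
  if h : i < n - 1 then conjPerm (TUnit ⟨i, h⟩) else 1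

/-- The element `E_i`, with index a natural number. -/
noncomputable def natE (n i : ℕ) : BtAlg n := if h : i < n - 1 then E ⟨i, h⟩ else 1

theorem val_TUnit (i : Fin (n - 1)) : (TUnit i : BtAlg n) = T i := rfl

/-- `T_i` is not an involution, but `T_i²` differs from `1` by a multiple of `E_i T_i`, which
commutes with `E_j`. Conjugation by `T_i` is thus involutive on the neighbouring `E_j`, as `sq_up`
and `sq_down` require. -/
theorem T_T_E {i j : Fin (n - 1)} (h : Near i j) : T i * T i * E j = E j * (T i * T i) := by
  have h1 : T i * E i * E j = E j * (T i * E i) := by rw [← E_E_T h, E_comm, mul_assoc, E_T]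
  rw [T_sq, add_mul, mul_add, smul_mul_assoc, mul_smul_comm, E_T, h1, one_mul, mul_one]

theorem isTiedFamily_conjT : IsTiedFamily (n - 1) (conjT n) (natE n) where
  comm i j x hij hj := by
    rw [conjT, conjT, dif_pos hj, dif_pos (by omega), ← conjPerm_mul, ← conjPerm_mul]
    congr 2
    exact Units.ext (T_comm (Or.inl hij))
  braid i x hi := by
    rw [conjT, conjT, dif_pos hi, dif_pos (by omega)]
    simp only [← conjPerm_mul]
    congr 2
    refine Units.ext ?_
    simpa [val_TUnit, mul_assoc] using T_braid (i := ⟨i, by omega⟩) (j := ⟨i + 1, hi⟩) rfl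
  self i hi := by
    rw [conjT, natE, dif_pos hi, dif_pos hi, conjPerm_eq_iff]
    exact (E_T _).symm
  far i j hi hj hfar := by
    rw [conjT, natE, dif_pos hi, dif_pos hj, conjPerm_eq_iff]
    exact (E_T_far (i := ⟨j, hj⟩) (j := ⟨i, hi⟩) hfar.symm).symm
  near i hi := by
    rw [conjT, conjT, natE, natE, dif_pos hi, dif_pos hi, dif_pos (by omega), dif_pos (by omega),
      ← conjPerm_mul, conjPerm_eq_iff]
    have := E_T_T (i := ⟨i, by omega⟩) (j := ⟨i + 1, hi⟩) (Or.inl rfl)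
    rw [mul_assoc] at this
    exact this.symm
  sq_up i hi := by
    rw [conjT, natE, dif_pos (by omega), dif_pos hi, ← conjPerm_mul, conjPerm_eq_iff]
    exact T_T_E (Or.inl rfl)
  sq_down i hi := by
    rw [conjT, natE, dif_pos hi, dif_pos (by omega), ← conjPerm_mul, conjPerm_eq_iff]
    exact T_T_E (Or.inr rfl)

theorem filter_finRange_Ico {m a c : ℕ} (hac : a < c) (hc : c ≤ m) :
    (List.finRange m).filter (fun k => a ≤ k.val ∧ k.val < c) =
      ⟨a, by omega⟩ :: (List.finRange m).filter (fun k => a + 1 ≤ k.val ∧ k.val < c) := by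
  have hs : ∀ p : Fin m → Bool, ((List.finRange m).filter p).Pairwise (· < ·) := fun p =>
    (List.pairwise_lt_finRange m).filter p
  have hs' : ((⟨a, by omega⟩ : Fin m) ::
      (List.finRange m).filter (fun k => a + 1 ≤ k.val ∧ k.val < c)).Pairwise (· < ·) := by
    refine List.pairwise_cons.2 ⟨fun k hk => ?_, hs _⟩
    simp at hk
    exact Fin.lt_def.2 (by simp; omega)
  -- Strictly increasing lists with the same members coincide.
  refine List.Perm.eq_of_pairwise (fun a b _ _ h h' => absurd h (lt_asymm h')) (hs _) hs' ?_
  refine (List.perm_ext_iff_of_nodup ((hs _).imp fun h => h.ne) (hs'.imp fun h => h.ne)).2 ?_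
  intro k
  simp [Fin.ext_iff]
  omega

theorem TSeg_self (a : ℕ) : (TSeg a a : (BtAlg n)ˣ) = 1 := by
  rw [TSeg, List.filter_eq_nil_iff.2, List.map_nil, List.prod_nil]
  intro k _
  simp

theorem TSeg_succ {a c : ℕ} (hac : a < c) (hc : c ≤ n - 1) :
    (TSeg a c : (BtAlg n)ˣ) = TUnit ⟨a, by omega⟩ * TSeg (a + 1) c := by
  rw [TSeg, filter_finRange_Ico hac hc, List.map_cons, List.prod_cons, TSeg]

theorem strandPair_conjT {a k c : ℕ} (hc : a + k = c) (h : c < n - 1) :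
    strandPair (conjT n) (natE n) a k = conjPerm (TSeg a c) (E ⟨c, h⟩) := by
  induction k generalizing a with
  | zero =>
    obtain rfl : a = c := hc
    simp [strandPair, natE, h, TSeg_self, conjPerm_apply]
  | succ k ih =>
    rw [strandPair, ih (by omega), TSeg_succ (a := a) (by omega) (by omega), conjPerm_mul, conjT,
      dif_pos (by omega)]

theorem EPair_eq {a b : Fin n} (h : a < b) :
    EPair a b = strandPair (conjT n) (natE n) a (b.val - a.val - 1) := by
  have h' : a.val < b.val := h
  have := b.isLt
  rw [EPair, dif_pos h, strandPair_conjT (c := b.val - 1) (by omega) (by omega), conjPerm_apply]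

theorem EPair_of_not_lt {a b : Fin n} (h : ¬ a < b) : EPair a b = 1 := by
  rw [EPair, dif_neg h]

theorem swap_lo_hi_val (i : Fin (n - 1)) (j : Fin n) :
    (Equiv.swap (lo i) (hi i) j).val =
      if j.val = i.val then i.val + 1 else if j.val = i.val + 1 then i.val else j.val := by
  rw [Equiv.swap_apply_def]
  simp only [Fin.ext_iff, lo, hi]
  split_ifs <;> rfl

/-- The symmetric version of `E_{a,b}`; it is `1` for `a = b`. -/
noncomputable def EE (a b : Fin n) : BtAlg n := EPair a b * EPair b a

theorem EE_self (a : Fin n) : EE a a = 1 := by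
  rw [EE, EPair_of_not_lt (lt_irrefl a), one_mul]

theorem EE_of_lt {a b : Fin n} (h : a < b) : EE a b = EPair a b := by
  rw [EE, EPair_of_not_lt h.not_gt, mul_one]

theorem EE_comm (a b : Fin n) : EE a b = EE b a := by
  rcases lt_trichotomy a b with h | rfl | h
  · rw [EE_of_lt h, EE, EPair_of_not_lt h.not_gt, one_mul]
  · rfl
  · rw [EE_of_lt h, EE, EPair_of_not_lt h.not_gt, one_mul]

theorem EE_lo_hi (i : Fin (n - 1)) : EE (lo i) (hi i) = E i := by
  have h : lo i < hi i := Fin.lt_def.2 (Nat.lt_succ_self _)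
  rw [EE_of_lt h, EPair_eq h]
  simp [lo, hi, strandPair, natE]

theorem T_EE (i : Fin (n - 1)) (a b : Fin n) :
    T i * EE a b = EE (Equiv.swap (lo i) (hi i) a) (Equiv.swap (lo i) (hi i) b) * T i := by
  wlog hab : a < b generalizing a b
  · rcases eq_or_lt_of_le (not_lt.1 hab) with rfl | h
    · rw [EE_self, EE_self, one_mul, mul_one]
    · rw [EE_comm, this b a h, EE_comm]
  have hlt : a.val < b.val := hab
  have hb := b.isLt
  have hi' := i.isLt
  have key := (isTiedFamily_conjT (n := n)).strandPair_swap i.isLt hlt (by omega)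
  rw [conjT, dif_pos i.isLt, conjPerm_eq_iff, ← EPair_eq hab, ← EE_of_lt hab] at key
  rw [← val_TUnit, key]
  congr 1
  have ha' := swap_lo_hi_val i a
  have hb' := swap_lo_hi_val i b
  generalize Equiv.swap (lo i) (hi i) a = a' at *
  generalize Equiv.swap (lo i) (hi i) b = b' at *
  -- The transposition can reverse the order of the two strands; the symmetry of `EE` absorbs this.
  have fin : ∀ c d : ℕ, c < d → (c = a'.val ∧ d = b'.val ∨ c = b'.val ∧ d = a'.val) →
      strandPair (conjT n) (natE n) c (d - c - 1) = EE a' b' := by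
    rintro c d hcd (⟨rfl, rfl⟩ | ⟨rfl, rfl⟩)
    · rw [EE_of_lt hcd, EPair_eq hcd]
    · rw [EE_comm, EE_of_lt hcd, EPair_eq hcd]
  split_ifs with h1 h2 h3 h4 h5
  · rw [EE_of_lt hab, EPair_eq hab]; split_ifs at ha' hb' <;> exact fin _ _ (by omega) (by omega)
  all_goals split_ifs at ha' hb' <;> first | omega | skip
  all_goals first | exact fin _ _ (by omega) (by omega) | skip
  all_goals rw [EE_of_lt hab, EPair_eq hab]; exact fin _ _ (by omega) (by omega)

theorem B_EPair {a b : ℕ} (h : a + b < n - 1) :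
    B * strandPair (conjT n) (natE n) a b = strandPair (conjT n) (natE n) a b * B := by
  induction b with
  | zero => rw [strandPair, natE, dif_pos (by omega), B_E]
  | succ b ih =>
    have hB := ih (by omega)
    -- Extending on the right conjugates only by `T` of nonzero index, and these commute with `B`.
    rw [← (isTiedFamily_conjT (n := n)).strandPair_up (by omega), conjT, dif_pos (by omega)]
    have h1 : B * ((TUnit ⟨a + b + 1, by omega⟩ : (BtAlg n)ˣ) : BtAlg n) =
        ((TUnit ⟨a + b + 1, by omega⟩ : (BtAlg n)ˣ) : BtAlg n) * B :=
      B_T_comm (i := ⟨a + b + 1, by omega⟩) (by simp)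
    have h2 := (Commute.units_inv_right (a := (B : BtAlg n)) h1).eq
    rw [conjPerm_apply, ← mul_assoc, ← mul_assoc, h1, mul_assoc _ B, hB, ← mul_assoc, mul_assoc _ B,
      h2, ← mul_assoc]

theorem B_EE (a b : Fin n) : B * EE a b = EE a b * B := by
  wlog hab : a < b generalizing a b
  · rcases eq_or_lt_of_le (not_lt.1 hab) with rfl | h
    · rw [EE_self, one_mul, mul_one]
    · rw [EE_comm, this b a h]
  have hlt : a.val < b.val := hab
  have hb := b.isLt
  rw [EE_of_lt hab, EPair_eq hab, B_EPair (by omega)]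

end ConjT

/-! ### The idempotents `F_j` and `E_{i,j}` form one partition family -/

section TiedFamily

variable {n : ℕ}

/-- The unified family of idempotents: `F_j` for the pair `(0, j)` and `E_{i,j}` for `(i, j)`. -/
noncomputable def X (a b : Fin (n + 1)) : BtAlg n :=
  Fin.cases (Fin.cases 1 (fun j => F j) b) (fun i => Fin.cases (F i) (fun j => EE i j) b) a

@[simp] theorem X_zero_zero : X (0 : Fin (n + 1)) 0 = 1 := rfl
@[simp] theorem X_zero_succ (j : Fin n) : X 0 j.succ = F j := rfl
@[simp] theorem X_succ_zero (j : Fin n) : X j.succ 0 = F j := rfl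
@[simp] theorem X_succ_succ (i j : Fin n) : X i.succ j.succ = EE i j := rfl

theorem X_self (a : Fin (n + 1)) : X a a = 1 := by
  refine Fin.cases rfl (fun i => ?_) a
  rw [X_succ_succ, EE_self]

theorem X_comm (a b : Fin (n + 1)) : X a b = X b a := by
  refine Fin.cases ?_ (fun i => ?_) a <;> refine Fin.cases ?_ (fun j => ?_) b
  · rfl
  · rfl
  · rfl
  · exact EE_comm i j

/-- The coefficient of the quadratic relation of a node. -/
noncomputable def coef (s : Fin n) : K := if s.val = 0 then v - v⁻¹ else u - u⁻¹

theorem letter_of_ne {s : Fin n} (h : s.val ≠ 0) :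
    letter s = T ⟨s.val - 1, by have := s.isLt; omega⟩ := dif_neg h

theorem letter_of_eq {s : Fin n} (h : s.val = 0) : letter s = B := dif_pos h

theorem X_node_of_eq {s : Fin n} (h : s.val = 0) : X s.castSucc s.succ = F s := by
  have : s.castSucc = 0 := Fin.ext h
  rw [this, X_zero_succ]

theorem X_node_of_ne {s : Fin n} (h : s.val ≠ 0) :
    X s.castSucc s.succ = E ⟨s.val - 1, by have := s.isLt; omega⟩ := by
  rw [← EE_lo_hi, ← X_succ_succ]
  congr 1 <;> apply Fin.ext <;> simp [lo, hi] <;> omega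

theorem letter_sq (s : Fin n) :
    letter s * letter s = 1 + coef s • (X s.castSucc s.succ * letter s) := by
  by_cases h : s.val = 0
  · rw [letter_of_eq h, coef, if_pos h, X_node_of_eq h, B_sq h]
  · rw [letter_of_ne h, coef, if_neg h, X_node_of_ne h, T_sq]

theorem T_F (j : Fin n) (i : Fin (n - 1)) : T i * F j = F (Equiv.swap (lo i) (hi i) j) * T i := by
  rw [F_T, Equiv.swap_apply_self]

theorem strandSwap_zero (s : Fin n) : strandSwap s 0 = 0 := by rw [← tau_simple, tau_zero]

theorem strandSwap_succ {s : Fin n} (h : s.val ≠ 0) (j : Fin n) : strandSwap s j.succ =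
    (Equiv.swap (lo ⟨s.val - 1, by have := s.isLt; omega⟩)
      (hi ⟨s.val - 1, by have := s.isLt; omega⟩) j).succ := by
  apply Fin.ext
  rw [Fin.val_succ, swap_lo_hi_val]
  have h1 := strandSwap_val s j.succ
  rw [Fin.val_succ] at h1
  have h2 : strandSwap s j.succ = j.succ → (strandSwap s j.succ).val = j.val + 1 := fun h => by
    rw [h, Fin.val_succ]
  simp only
  rcases h1 with h1 | h1 | h1 | h1
  · omega
  · split_ifs <;> omega
  · split_ifs <;> omega
  · have := h2 h1.2.2
    split_ifs <;> omega

/-- The generators permute the idempotents. -/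
theorem letter_X (s : Fin n) (a b : Fin (n + 1)) :
    letter s * X a b = X (strandSwap s a) (strandSwap s b) * letter s := by
  by_cases h : s.val = 0
  · rw [letter_of_eq h]
    have e : strandSwap s = 1 := if_pos h
    simp only [e, Equiv.Perm.one_apply]
    refine Fin.cases ?_ (fun i => ?_) a <;> refine Fin.cases ?_ (fun j => ?_) b
    · simp
    · exact B_F j
    · exact B_F i
    · exact B_EE i j
  · rw [letter_of_ne h]
    refine Fin.cases ?_ (fun i => ?_) a <;> refine Fin.cases ?_ (fun j => ?_) b
    · rw [strandSwap_zero]; simp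
    · rw [strandSwap_zero, strandSwap_succ h]; exact T_F _ _
    · rw [strandSwap_zero, strandSwap_succ h]; exact T_F _ _
    · rw [strandSwap_succ h, strandSwap_succ h]; exact T_EE _ _ _

theorem strandSwap_castSucc_succ (s : Fin n) :
    (strandSwap s s.castSucc = s.castSucc ∧ strandSwap s s.succ = s.succ) ∨
    (strandSwap s s.castSucc = s.succ ∧ strandSwap s s.succ = s.castSucc) := by
  unfold strandSwap
  split_ifs
  · left; simp
  · right; simp

theorem letter_X_node (s : Fin n) :
    letter s * X s.castSucc s.succ = X s.castSucc s.succ * letter s := by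
  rw [letter_X]
  rcases strandSwap_castSucc_succ s with h | h
  · rw [h.1, h.2]
  · rw [h.1, h.2, X_comm]

/-- The generators attached to nodes are units. -/
noncomputable def letterUnit (s : Fin n) : (BtAlg n)ˣ where
  val := letter s
  inv := letter s - coef s • X s.castSucc s.succ
  val_inv := by rw [mul_sub, letter_sq, mul_smul_comm, letter_X_node, add_sub_cancel_right]
  inv_val := by rw [sub_mul, letter_sq, smul_mul_assoc, add_sub_cancel_right]

theorem exists_unit_X (w : W n) : ∃ U : (BtAlg n)ˣ, ∀ a b : Fin (n + 1),
    U * X a b = X (tau w a) (tau w b) * U := by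
  obtain ⟨ω, rfl⟩ := (cs n).wordProd_surjective w
  rw [tau_wordProd]
  induction ω with
  | nil => exact ⟨1, fun a b => by simp⟩
  | cons s ω ih =>
    obtain ⟨U, hU⟩ := ih
    refine ⟨letterUnit s * U, fun a b => ?_⟩
    have := letter_X s
    rw [Units.val_mul, mul_assoc, hU, ← mul_assoc, show (letterUnit s : BtAlg n) = letter s from rfl,
      this, mul_assoc]
    simp

/-- Every relabelling of the moving strands is realised by conjugation with a unit. Identities
between the `F_a` and `EE a b` can therefore be transported from adjacent strands to arbitrary ones.
-/
theorem exists_monoidHom_X (e : Equiv.Perm (Fin n)) : ∃ θ : BtAlg n →* BtAlg n,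
    (∀ a, θ (F a) = F (e a)) ∧ ∀ a b, θ (EE a b) = EE (e a) (e b) := by
  obtain ⟨w, hw⟩ := exists_tau_succ e
  obtain ⟨U, hU⟩ := exists_unit_X w
  refine ⟨⟨⟨conjPerm U, by simp [conjPerm_apply]⟩,
    fun x y => by simp [conjPerm_apply, mul_assoc]⟩, fun a => ?_, fun a b => ?_⟩
  · refine (conjPerm_eq_iff U _ _).2 ?_
    rw [← X_zero_succ, hU, tau_zero, hw, X_zero_succ]
  · refine (conjPerm_eq_iff U _ _).2 ?_
    rw [← X_succ_succ, hU, hw, hw, X_succ_succ]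

theorem exists_perm_two {a b : Fin n} (h : a ≠ b) : ∃ (i : Fin (n - 1)) (e : Equiv.Perm (Fin n)),
    i.val = 0 ∧ e (lo i) = a ∧ e (hi i) = b := by
  have hn : 2 ≤ n := by
    have := Fin.val_ne_of_ne h
    have := a.isLt
    have := b.isLt
    omega
  have hi1 : lo (n := n) ⟨0, by omega⟩ ≠ hi ⟨0, by omega⟩ := by simp [lo, hi]
  have h2 := (Equiv.Perm.isMultiplyPretransitive (Fin n) 2).exists_smul_eq
    ⟨![lo ⟨0, by omega⟩, hi ⟨0, by omega⟩], by
      intro x y; fin_cases x <;> fin_cases y <;> simp [hi1, hi1.symm]⟩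
    ⟨![a, b], by intro x y; fin_cases x <;> fin_cases y <;> simp [h, h.symm]⟩
  obtain ⟨e, he⟩ := h2
  refine ⟨⟨0, by omega⟩, e, rfl, ?_, ?_⟩
  · exact DFunLike.congr_fun he 0
  · exact DFunLike.congr_fun he 1

theorem exists_perm_three {a b c : Fin n} (hab : a ≠ b) (hac : a ≠ c) (hbc : b ≠ c) :
    ∃ (i j : Fin (n - 1)) (e : Equiv.Perm (Fin n)),
      i.val + 1 = j.val ∧ e (lo i) = a ∧ e (lo j) = b ∧ e (hi j) = c := by
  have hn : 3 ≤ n := by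
    have := Fin.val_ne_of_ne hab
    have := Fin.val_ne_of_ne hac
    have := Fin.val_ne_of_ne hbc
    have := a.isLt
    have := b.isLt
    have := c.isLt
    omega
  have h2 := (Equiv.Perm.isMultiplyPretransitive (Fin n) 3).exists_smul_eq
    ⟨![⟨0, by omega⟩, ⟨1, by omega⟩, ⟨2, by omega⟩], by
      intro x y; fin_cases x <;> fin_cases y <;> simp⟩
    ⟨![a, b, c], by
      intro x y
      fin_cases x <;> fin_cases y <;> simp [hab, hab.symm, hac, hac.symm, hbc, hbc.symm]⟩
  obtain ⟨e, he⟩ := h2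
  refine ⟨⟨0, by omega⟩, ⟨1, by omega⟩, e, rfl, ?_, ?_, ?_⟩
  · exact DFunLike.congr_fun he 0
  · exact DFunLike.congr_fun he 1
  · exact DFunLike.congr_fun he 2

/-- Commutation of the `F_j` is not a defining relation. Moving `T_i` across `F_i F_{i+1}` reverses
the two factors, but the product equals `E_i F_{i+1}` and also `E_i F_i`, hence commutes with `T_i`;
cancel `T_i`. -/
theorem F_F_node (i : Fin (n - 1)) : F (lo i) * F (hi i) = F (hi i) * F (lo i) := by
  have h1 : F (lo i) * F (hi i) * T i = T i * (F (hi i) * F (lo i)) := by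
    rw [mul_assoc, F_T, Equiv.swap_apply_right, ← mul_assoc, F_T, Equiv.swap_apply_left, mul_assoc]
  have h2 : F (lo i) * F (hi i) * T i = T i * (F (lo i) * F (hi i)) := by
    rw [E_F_hi, mul_assoc, F_T, Equiv.swap_apply_right, ← mul_assoc, E_T, mul_assoc, E_F_lo,
      ← E_F_hi]
  exact (TUnit i).mul_right_inj.1 (h2.symm.trans h1)

theorem F_comm (a b : Fin n) : F a * F b = F b * F a := by
  by_cases h : a = b
  · rw [h]
  · obtain ⟨i, e, -, rfl, rfl⟩ := exists_perm_two h
    obtain ⟨θ, h1, -⟩ := exists_monoidHom_X e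
    simpa only [map_mul, h1] using congrArg θ (F_F_node i)

theorem F_EE (c a b : Fin n) : F c * EE a b = EE a b * F c := by
  by_cases h : a = b
  · rw [h, EE_self, one_mul, mul_one]
  · obtain ⟨i, e, -, rfl, rfl⟩ := exists_perm_two h
    obtain ⟨θ, h1, h2⟩ := exists_monoidHom_X e
    have := congrArg θ (F_E (e.symm c) i)
    rw [← EE_lo_hi, map_mul, map_mul, h1, h2, Equiv.apply_symm_apply] at this
    exact this

theorem EE_F_left (a b : Fin n) : EE a b * F a = F a * F b := by
  by_cases h : a = b
  · rw [h, EE_self, one_mul, F_sq]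
  · obtain ⟨i, e, -, rfl, rfl⟩ := exists_perm_two h
    obtain ⟨θ, h1, h2⟩ := exists_monoidHom_X e
    have := congrArg θ (E_F_lo i)
    rw [← EE_lo_hi, map_mul, map_mul, h1, h2, h1] at this
    exact this

theorem EE_sq (a b : Fin n) : EE a b * EE a b = EE a b := by
  by_cases h : a = b
  · rw [h, EE_self, one_mul]
  · obtain ⟨i, e, -, rfl, rfl⟩ := exists_perm_two h
    obtain ⟨θ, -, h2⟩ := exists_monoidHom_X e
    have := congrArg θ (E_sq i)
    rw [← EE_lo_hi, map_mul, h2] at this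
    exact this

theorem lo_eq_hi {i j : Fin (n - 1)} (h : i.val + 1 = j.val) : lo j = hi i := Fin.ext h.symm

theorem EE_trans (a b c : Fin n) : EE a b * EE b c = EE a b * EE a c := by
  by_cases hab : a = b
  · rw [hab]
  by_cases hbc : b = c
  · rw [hbc, EE_self, mul_one, EE_sq]
  by_cases hac : a = c
  · rw [hac, EE_self, mul_one, EE_comm b c, EE_sq]
  obtain ⟨i, j, e, hij, rfl, rfl, rfl⟩ := exists_perm_three hab hac hbc
  obtain ⟨θ, -, h2⟩ := exists_monoidHom_X e
  -- On consecutive strands, `E_i E_j T_i = T_i E_i E_j = E_i T_i E_j = E_i E_{i,i+2} T_i` with `j =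
  -- i + 1`; then `T_i` is cancelled.
  have key : EE (lo i) (lo j) * EE (lo j) (hi j) = EE (lo i) (lo j) * EE (lo i) (hi j) := by
    have h1 : T i * EE (lo j) (hi j) = EE (lo i) (hi j) * T i := by
      rw [T_EE, lo_eq_hi hij, Equiv.swap_apply_right, Equiv.swap_apply_of_ne_of_ne]
      · simp [Fin.ext_iff, lo, hi]; omega
      · simp [Fin.ext_iff, hi]; omega
    have h3 := E_E_T (i := i) (j := j) (Or.inl hij)
    rw [EE_lo_hi] at h1 ⊢
    rw [lo_eq_hi hij, EE_lo_hi]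
    apply (TUnit i).mul_left_inj.1
    change E i * E j * T i = E i * EE (lo i) (hi j) * T i
    rw [h3, mul_assoc (E i), ← h1, ← mul_assoc, E_T]
  simpa only [map_mul, h2] using congrArg θ key

theorem u_sub_inv_ne_zero : u - u⁻¹ ≠ 0 := by
  intro h
  have hu : u ≠ 0 := by
    rw [u, Ne, FaithfulSMul.algebraMap_eq_zero_iff]
    exact MvPolynomial.X_ne_zero 0
  have h1 : u * u = 1 := by
    rw [sub_eq_zero] at h
    nth_rewrite 1 [h]
    exact inv_mul_cancel₀ hu
  rw [u, ← map_mul, ← map_one (algebraMap (MvPolynomial (Fin 2) ℂ) K)] at h1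
  have h2 := IsFractionRing.injective (MvPolynomial (Fin 2) ℂ) K h1
  simpa using congrArg (MvPolynomial.eval 0) h2

/-- Whatever commutes with `T_i` commutes with `T_i⁻¹`, hence with `E_i`. This yields commutation
for disjoint pairs of strands in `EE_EE_comm`. -/
theorem E_eq_smul (i : Fin (n - 1)) :
    E i = (u - u⁻¹)⁻¹ • (T i - ((TUnit i)⁻¹ : (BtAlg n)ˣ)) := by
  have : (((TUnit i)⁻¹ : (BtAlg n)ˣ) : BtAlg n) = T i - (u - u⁻¹) • E i := rfl
  rw [this, sub_sub_cancel, smul_smul, inv_mul_cancel₀ u_sub_inv_ne_zero, one_smul]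

theorem EE_EE_comm (a b c d : Fin n) : EE a b * EE c d = EE c d * EE a b := by
  have three : ∀ a b c : Fin n, EE a b * EE b c = EE b c * EE a b := by
    intro a b c
    by_cases hab : a = b
    · rw [hab, EE_self, one_mul, mul_one]
    by_cases hbc : b = c
    · rw [hbc, EE_self, one_mul, mul_one]
    by_cases hac : a = c
    · rw [hac, EE_comm b c]
    obtain ⟨i, j, e, hij, rfl, rfl, rfl⟩ := exists_perm_three hab hac hbc
    obtain ⟨θ, -, h2⟩ := exists_monoidHom_X e
    have key : EE (lo i) (lo j) * EE (lo j) (hi j) = EE (lo j) (hi j) * EE (lo i) (lo j) := by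
      rw [EE_lo_hi, lo_eq_hi hij, EE_lo_hi, E_comm]
    simpa only [map_mul, h2] using congrArg θ key
  by_cases hab : a = b
  · rw [hab, EE_self, one_mul, mul_one]
  by_cases hac : a = c
  · rw [hac, EE_comm c b, three]
  by_cases hbc : b = c
  · rw [hbc, three]
  by_cases had : a = d
  · rw [had, EE_comm d b, EE_comm c d, three]
  by_cases hbd : b = d
  · rw [hbd, EE_comm c d, three]
  obtain ⟨i, e, -, rfl, rfl⟩ := exists_perm_two hab
  obtain ⟨θ, -, h2⟩ := exists_monoidHom_X e
  -- The pairs are now disjoint, so the transposition of `T_i` fixes both strands of the second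
  -- idempotent.
  have h1 : T i * EE (e.symm c) (e.symm d) = EE (e.symm c) (e.symm d) * T i := by
    rw [T_EE, Equiv.swap_apply_of_ne_of_ne, Equiv.swap_apply_of_ne_of_ne]
    all_goals intro h; rw [Equiv.symm_apply_eq] at h
    · exact had h.symm
    · exact hbd h.symm
    · exact hac h.symm
    · exact hbc h.symm
  have h3 : Commute ((TUnit i : (BtAlg n)ˣ) : BtAlg n) (EE (e.symm c) (e.symm d)) := h1
  have key : EE (lo i) (hi i) * EE (e.symm c) (e.symm d) =
      EE (e.symm c) (e.symm d) * EE (lo i) (hi i) := by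
    rw [EE_lo_hi, E_eq_smul, smul_mul_assoc, mul_smul_comm, sub_mul, mul_sub, h1,
      h3.units_inv_left.eq]
  have := congrArg θ key
  simpa only [map_mul, h2, Equiv.apply_symm_apply] using this

theorem isPartitionFamily_X : IsPartitionFamily (X (n := n)) where
  refl := X_self
  symm := X_comm
  comm a b c d := by
    refine Fin.cases ?_ (fun i => ?_) a <;> refine Fin.cases ?_ (fun j => ?_) b <;>
    refine Fin.cases ?_ (fun k => ?_) c <;> refine Fin.cases ?_ (fun l => ?_) d <;>
    simp only [X_zero_zero, X_zero_succ, X_succ_zero, X_succ_succ, one_mul, mul_one, F_EE]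
    all_goals first | exact F_comm _ _ | exact EE_EE_comm _ _ _ _
  idem a b := by
    refine Fin.cases ?_ (fun i => ?_) a <;> refine Fin.cases ?_ (fun j => ?_) b
    · simp
    · exact F_sq j
    · exact F_sq i
    · exact EE_sq i j
  trans a b c := by
    refine Fin.cases ?_ (fun i => ?_) a <;> refine Fin.cases ?_ (fun j => ?_) b <;>
    refine Fin.cases ?_ (fun k => ?_) c
    · rfl
    · simp
    · simpa using F_sq j
    · simpa [F_EE] using EE_F_left j k
    · simpa using (F_sq i).symm
    · simpa [F_EE] using (EE_F_left i k).symm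
    · rw [X_succ_succ, X_succ_zero, X_succ_zero, EE_F_left, F_comm, EE_comm, EE_F_left]
    · exact EE_trans i j k

end TiedFamily

/-- The hypotheses say that the pairs of `P` generate `r`. Any generating list gives the same
product. -/
theorem IsPartitionFamily.list_prod_eq {α R : Type*} [Monoid R] [Fintype α] {x : α → α → R}
    (hx : IsPartitionFamily x) {r : Setoid α} (P : List (α × α)) (hP : ∀ p ∈ P, r p.1 p.2)
    (hr : ∀ s : Setoid α, (∀ p ∈ P, s p.1 p.2) → r ≤ s) :
    (P.map fun p => x p.1 p.2).prod = partProd x r := by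
  apply hx.eq_partProd
  · apply hr
    intro p hp
    rw [hx.fixSetoid_iff]
    apply mul_list_prod_of_mem
    · intro z hz
      obtain ⟨q, -, rfl⟩ := List.mem_map.1 hz
      exact hx.comm _ _ _ _
    · exact List.mem_map.2 ⟨p, hp, rfl⟩
    · exact hx.idem _ _
  · apply mul_list_prod_eq
    intro y hy
    obtain ⟨p, hp, rfl⟩ := List.mem_map.1 hy
    exact hx.partProd_mul (hP p hp)

/-! ### `EF_I` is the product over the equivalence relation of `I` -/

section EF

variable {n : ℕ}

theorem mem_star {A : Finset (Fin (n + 1))} {j : Fin n} : j ∈ star A ↔ j.succ ∈ A := by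
  simp [star]

/-- The pairs of moving strands that contribute to `E_J`. -/
def blockPairs (J : Finset (Fin n)) : List (Fin (n + 1) × Fin (n + 1)) :=
  ((List.finRange n ×ˢ List.finRange n).filter
    fun p => p.1 ∈ J ∧ p.2 ∈ J ∧ p.1 < p.2).map fun p => (p.1.succ, p.2.succ)

theorem mem_blockPairs {J : Finset (Fin n)} {p : Fin (n + 1) × Fin (n + 1)} :
    p ∈ blockPairs J ↔ ∃ i j, i ∈ J ∧ j ∈ J ∧ i < j ∧ p = (i.succ, j.succ) := by
  simp only [blockPairs, List.mem_map, List.mem_filter, Prod.exists, decide_eq_true_eq]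
  constructor
  · rintro ⟨i, j, ⟨-, h1, h2, h3⟩, rfl⟩
    exact ⟨i, j, h1, h2, h3, rfl⟩
  · rintro ⟨i, j, h1, h2, h3, rfl⟩
    exact ⟨i, j, ⟨by simp, h1, h2, h3⟩, rfl⟩

theorem EBlock_eq (J : Finset (Fin n)) :
    EBlock J = ((blockPairs J).map fun p => X p.1 p.2).prod := by
  rw [EBlock, blockPairs, List.map_map]
  congr 1
  apply List.map_congr_left
  intro p hp
  have : p.1 < p.2 := by
    have := (List.mem_filter.1 hp).2
    simp only [decide_eq_true_eq] at this
    exact this.2.2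
  rw [Function.comp, X_succ_succ, EE_of_lt this]

/-- The pairs of strands that contribute to `EF_I`. -/
def partPairs (I : SetPart n) : List (Fin (n + 1) × Fin (n + 1)) :=
  ((leaders I).map fun j => blockPairs (star (I.part j.succ))).flatten ++
    ((List.finRange n).filter fun j => j ∈ star (I.part 0)).map fun j => (0, j.succ)

theorem EF_eq_list (I : SetPart n) : EF I = ((partPairs I).map fun p => X p.1 p.2).prod := by
  rw [EF, partPairs, List.map_append, List.prod_append, List.map_flatten, List.prod_flatten,
    List.map_map, List.map_map, List.map_map, FSet]
  congr 2
  apply List.map_congr_left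
  intro j _
  exact EBlock_eq _

theorem part_eq {I : SetPart n} {a b : Fin (n + 1)} (h : b ∈ I.part a) : I.part b = I.part a :=
  (I.mem_part_iff_part_eq_part (Finset.mem_univ _) (Finset.mem_univ _)).1 h

theorem mem_part_self (I : SetPart n) (a : Fin (n + 1)) : a ∈ I.part a :=
  I.mem_part_self.2 (Finset.mem_univ a)

/-- The pairs in `EF_I` generate the relation of `I`: the block of `0` contributes all pairs with
`0`, and every other block all its pairs. -/
theorem EF_eq (I : SetPart n) : EF I = partProd X (partSetoid I) := by
  rw [EF_eq_list]
  apply isPartitionFamily_X.list_prod_eq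
  · intro p hp
    rcases List.mem_append.1 hp with hp | hp
    · obtain ⟨l, hl, hp⟩ := List.mem_flatten.1 hp
      obtain ⟨k, -, rfl⟩ := List.mem_map.1 hl
      obtain ⟨i, j, hi, hj, -, rfl⟩ := mem_blockPairs.1 hp
      rw [partSetoid_iff, part_eq (mem_star.1 hi)]
      exact mem_star.1 hj
    · obtain ⟨j, hj, rfl⟩ := List.mem_map.1 hp
      rw [partSetoid_iff]
      simpa [mem_star] using hj
  · intro s hs
    have h0 : ∀ b, b ∈ I.part 0 → s 0 b := by
      intro b
      refine Fin.cases (fun _ => s.refl' 0) (fun j hj => ?_) b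
      refine hs (0, j.succ) (List.mem_append_right _ (List.mem_map.2 ⟨j, ?_, rfl⟩))
      simpa [mem_star] using hj
    have h1 : ∀ i j : Fin n, i < j → j.succ ∈ I.part i.succ → (0 : Fin (n + 1)) ∉ I.part i.succ →
        s i.succ j.succ := by
      intro i j hij hj h
      have hi : i ∈ star (I.part i.succ) := mem_star.2 (mem_part_self I _)
      -- The block is listed under its least strand, which need not be `i`.
      obtain ⟨l, hl, hmin⟩ := Finset.exists_min_image (star (I.part i.succ)) id ⟨i, hi⟩
      have hp := part_eq (mem_star.1 hl)
      refine hs (i.succ, j.succ) (List.mem_append_left _ (List.mem_flatten.2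
        ⟨blockPairs (star (I.part l.succ)), List.mem_map.2 ⟨l, ?_, rfl⟩, ?_⟩))
      · rw [leaders, List.mem_filter, hp]
        exact ⟨by simp, by simpa using ⟨h, hmin⟩⟩
      · rw [hp]
        exact mem_blockPairs.2 ⟨i, j, hi, mem_star.2 hj, hij, rfl⟩
    intro a b hab
    rw [partSetoid_iff] at hab
    by_cases ha : a ∈ I.part 0
    · rw [part_eq ha] at hab
      exact s.trans' (s.symm' (h0 a ha)) (h0 b hab)
    · have ha' : (0 : Fin (n + 1)) ∉ I.part a := fun h => ha (by
        rw [part_eq h]; exact mem_part_self I a)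
      have hb' : (0 : Fin (n + 1)) ∉ I.part b := by rwa [part_eq hab]
      have hba : a ∈ I.part b := by rw [part_eq hab]; exact mem_part_self I a
      revert ha' hb' hab hba
      refine Fin.cases (fun _ h _ _ => absurd (mem_part_self I 0) h) (fun i => ?_) a
      refine Fin.cases (fun _ _ h _ => absurd (mem_part_self I 0) h) (fun j => ?_) b
      intro hab ha' hb' hba
      rcases lt_trichotomy i j with h | rfl | h
      · exact h1 i j h hab ha'
      · exact s.refl' _
      · exact s.symm' (h1 j i h hba hb')

end EF

/-! ### `T_w` and its products with the generators -/

section Spanning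

variable {n : ℕ}

theorem isBraidFamily_letter : IsBraidFamily (letter (n := n)) where
  comm s t h := by
    rw [letter_of_ne (s := t) (by omega)]
    by_cases hs : s.val = 0
    · rw [letter_of_eq hs]
      exact B_T_comm (by simp; omega)
    · rw [letter_of_ne hs]
      exact T_comm (Or.inl (by simp; omega))
  braid s t h0 h := by
    rw [letter_of_ne (s := t) (by omega), letter_of_ne (s := s) (by omega)]
    exact T_braid (by simp; omega)
  braid₄ s t h0 h := by
    rw [letter_of_ne (s := t) (by omega), letter_of_eq h0]
    exact B_T_braid (by simp; omega)

/-- Matsumoto's theorem for the family `letter`, compared with the word chosen in `TW`. -/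
theorem TW_wordProd {ω : List (Fin n)} (h : (cs n).IsReduced ω) :
    TW ((cs n).wordProd ω) = wordT ω := by
  have hc := ((cs n).exists_isReduced ((cs n).wordProd ω)).choose_spec
  refine matsumoto_signed isBraidFamily_letter ((isReduced_iff _).1 hc.1) ((isReduced_iff _).1 h) ?_
  rw [← phi_wordProd, ← phi_wordProd, ← hc.2]

/-- `s` is a left descent of `w`. -/
def LDesc (s : Fin n) (w : W n) : Prop := Desc (phi w⁻¹) s

theorem lDesc_simple_mul (s : Fin n) (w : W n) :
    LDesc s ((cs n).simple s * w) ↔ ¬ LDesc s w := by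
  rw [LDesc, mul_inv_rev, CoxeterSystem.inv_simple, map_mul, phi_simple, desc_mul_signedSwap, LDesc]

theorem isReduced_cons {ω : List (Fin n)} {s : Fin n} (hω : (cs n).IsReduced ω)
    (h : ¬ LDesc s ((cs n).wordProd ω)) : (cs n).IsReduced (s :: ω) := by
  rw [isReduced_iff] at hω ⊢
  rw [LDesc, map_inv, phi_wordProd] at h
  exact isMin_cons_of_not_desc hω h

theorem letter_mul_TW {s : Fin n} {w : W n} (h : ¬ LDesc s w) :
    letter s * TW w = TW ((cs n).simple s * w) := by
  obtain ⟨ω, hω, rfl⟩ := (cs n).exists_isReduced w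
  rw [← CoxeterSystem.wordProd_cons, TW_wordProd (isReduced_cons hω h), TW_wordProd hω]
  rfl

theorem letter_mul_TW_of_lDesc {s : Fin n} {w : W n} (h : LDesc s w) :
    letter s * TW w = TW ((cs n).simple s * w) + coef s • (X s.castSucc s.succ * TW w) := by
  have h' : ¬ LDesc s ((cs n).simple s * w) := by rw [lDesc_simple_mul]; simpa using h
  have e := letter_mul_TW h'
  rw [CoxeterSystem.simple_mul_simple_cancel_left] at e
  rw [← e, ← mul_assoc, letter_sq, add_mul, one_mul, smul_mul_assoc, mul_assoc]

theorem TW_one : TW (1 : W n) = 1 := by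
  have := TW_wordProd (n := n) (ω := []) (by simp [CoxeterSystem.IsReduced])
  rwa [CoxeterSystem.wordProd_nil] at this

end Spanning

/-! ### The action of `W n` on equivalence relations -/

section Action

variable {n : ℕ}

theorem tau_inv_tau (w : W n) (a : Fin (n + 1)) : tau w⁻¹ (tau w a) = a := by
  rw [← Equiv.Perm.mul_apply, ← map_mul, inv_mul_cancel, map_one, Equiv.Perm.one_apply]

theorem tau_tau_inv (w : W n) (a : Fin (n + 1)) : tau w (tau w⁻¹ a) = a := by
  rw [← Equiv.Perm.mul_apply, ← map_mul, mul_inv_cancel, map_one, Equiv.Perm.one_apply]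

/-- The action of `W_n` on the equivalence relations on the strands. -/
noncomputable def act (w : W n) : Setoid (Fin (n + 1)) ≃o Setoid (Fin (n + 1)) where
  toFun r := r.comap (tau w⁻¹)
  invFun r := r.comap (tau w)
  left_inv r := Setoid.ext fun a b => by
    rw [Setoid.comap_rel, Setoid.comap_rel, tau_inv_tau, tau_inv_tau]
  right_inv r := Setoid.ext fun a b => by
    rw [Setoid.comap_rel, Setoid.comap_rel, tau_tau_inv, tau_tau_inv]
  map_rel_iff' := by
    intro r r'
    constructor
    · intro h a b hab
      have : r (tau w⁻¹ (tau w a)) (tau w⁻¹ (tau w b)) →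
        r' (tau w⁻¹ (tau w a)) (tau w⁻¹ (tau w b)) := @h (tau w a) (tau w b)
      rw [tau_inv_tau, tau_inv_tau] at this
      exact this hab
    · intro h a b hab
      exact h hab

theorem act_apply (w : W n) (r : Setoid (Fin (n + 1))) (a b : Fin (n + 1)) :
    act w r a b ↔ r (tau w⁻¹ a) (tau w⁻¹ b) := Iff.rfl

theorem act_le_iff (w : W n) (r t : Setoid (Fin (n + 1))) : act w r ≤ t ↔
    ∀ a b, r a b → t (tau w a) (tau w b) := by
  constructor
  · intro h a b hab
    refine h ((act_apply w r _ _).2 ?_)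
    rwa [tau_inv_tau, tau_inv_tau]
  · intro h a b hab
    have := h _ _ ((act_apply w r _ _).1 hab)
    rwa [tau_tau_inv, tau_tau_inv] at this

theorem act_one (r : Setoid (Fin (n + 1))) : act 1 r = r :=
  Setoid.ext fun a b => by rw [act_apply, inv_one, map_one]; rfl

theorem act_mul (w w' : W n) (r : Setoid (Fin (n + 1))) : act (w * w') r = act w (act w' r) :=
  Setoid.ext fun a b => by
    rw [act_apply, mul_inv_rev, map_mul]; rfl

theorem act_pair (w : W n) (a b : Fin (n + 1)) :
    act w (pairSetoid a b) = pairSetoid (tau w a) (tau w b) := by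
  refine eq_of_forall_ge_iff fun t => ?_
  rw [pairSetoid_le, act_le_iff]
  constructor
  · intro h
    exact h a b (pairSetoid_le.1 le_rfl)
  · intro h c d hcd
    have : pairSetoid a b ≤ t.comap (tau w) := pairSetoid_le.2 h
    exact this hcd

theorem pairSetoid_comm {α : Type*} (a b : α) : pairSetoid a b = pairSetoid b a :=
  eq_of_forall_ge_iff fun t => by rw [pairSetoid_le, pairSetoid_le, t.comm']

/-- The equivalence relation that identifies the two strands of a node. -/
def nodeSetoid (s : Fin n) : Setoid (Fin (n + 1)) := pairSetoid s.castSucc s.succ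

theorem rel_strandSwap {s : Fin n} {t : Setoid (Fin (n + 1))} (h : nodeSetoid s ≤ t)
    (a : Fin (n + 1)) : t (strandSwap s a) a := by
  rw [nodeSetoid, pairSetoid_le] at h
  unfold strandSwap
  split_ifs
  · exact t.refl' a
  · rw [Equiv.swap_apply_def]
    split_ifs with h1 h2
    · rw [h1]; exact t.symm' h
    · rw [h2]; exact h
    · exact t.refl' a

/-- Once the two strands of the node are identified, exchanging them has no effect. Most
compatibilities of the regular module reduce to this. -/
theorem node_sup_act_simple (s : Fin n) (r : Setoid (Fin (n + 1))) :
    nodeSetoid s ⊔ act ((cs n).simple s) r = nodeSetoid s ⊔ r := by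
  refine eq_of_forall_ge_iff fun t => ?_
  rw [sup_le_iff, sup_le_iff, and_congr_right_iff]
  intro h
  rw [act_le_iff, tau_simple]
  constructor
  · intro h' a b hab
    exact t.trans' (t.symm' (rel_strandSwap h a)) (t.trans' (h' a b hab) (rel_strandSwap h b))
  · intro h' a b hab
    exact t.trans' (rel_strandSwap h a) (t.trans' (h' hab) (t.symm' (rel_strandSwap h b)))

theorem act_simple_node (s : Fin n) : act ((cs n).simple s) (nodeSetoid s) = nodeSetoid s := by
  rw [nodeSetoid, act_pair, tau_simple]
  rcases strandSwap_castSucc_succ s with h | h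
  · rw [h.1, h.2]
  · rw [h.1, h.2, pairSetoid_comm]

theorem act_node_of_rootPair {w : W n} {s t : Fin n} (h : RootPair (phi w) s t) :
    act w (nodeSetoid t) = nodeSetoid s := by
  rw [nodeSetoid, act_pair, nodeSetoid]
  rcases tau_of_rootPair h with h | h
  · rw [h.1, h.2]
  · rw [h.1, h.2, pairSetoid_comm]

theorem act_simple_simple (s : Fin n) (r : Setoid (Fin (n + 1))) :
    act ((cs n).simple s) (act ((cs n).simple s) r) = r := by
  rw [← act_mul, CoxeterSystem.simple_mul_simple_self, act_one]

theorem letter_mul_partProd (s : Fin n) (r : Setoid (Fin (n + 1))) :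
    letter s * partProd X r = partProd X (act ((cs n).simple s) r) * letter s := by
  classical
  have key : ∀ P : List (Fin (n + 1) × Fin (n + 1)),
      letter s * (P.map fun p => X p.1 p.2).prod =
        ((P.map fun p => (strandSwap s p.1, strandSwap s p.2)).map fun p => X p.1 p.2).prod *
          letter s := by
    intro P
    induction P with
    | nil => simp
    | cons p P ih =>
      rw [List.map_cons, List.prod_cons, ← mul_assoc, letter_X, mul_assoc, ih, List.map_cons,
        List.map_cons, List.prod_cons, mul_assoc]
  rw [partProd, key, isPartitionFamily_X.list_prod_eq (r := act ((cs n).simple s) r)]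
  · intro p hp
    obtain ⟨q, hq, rfl⟩ := List.mem_map.1 hp
    have := (act_le_iff ((cs n).simple s) r _).1 le_rfl q.1 q.2 (by simpa using hq)
    rwa [tau_simple] at this
  · intro t ht
    rw [act_le_iff, tau_simple]
    intro a b hab
    exact ht _ (List.mem_map.2 ⟨(a, b), by simpa using hab, rfl⟩)

end Action

/-! ### The elements `EF_I T_w` span -/

section Span

variable {n : ℕ}

/-- The elements `EF_I T_w`, indexed by equivalence relations instead of set partitions. -/
noncomputable def basisElt (p : Setoid (Fin (n + 1)) × W n) : BtAlg n := partProd X p.1 * TW p.2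

theorem X_mul_basisElt (a b : Fin (n + 1)) (r : Setoid (Fin (n + 1))) (w : W n) :
    X a b * basisElt (r, w) = basisElt (pairSetoid a b ⊔ r, w) := by
  rw [basisElt, basisElt, ← mul_assoc, ← isPartitionFamily_X.partProd_pair a b,
    isPartitionFamily_X.partProd_sup]

theorem letter_mul_basisElt_mem (s : Fin n) (r : Setoid (Fin (n + 1))) (w : W n) :
    letter s * basisElt (r, w) ∈ Submodule.span K (Set.range (basisElt (n := n))) := by
  rw [basisElt, ← mul_assoc, letter_mul_partProd, mul_assoc]
  by_cases h : LDesc s w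
  · rw [letter_mul_TW_of_lDesc h, mul_add, mul_smul_comm, ← mul_assoc,
      ← isPartitionFamily_X.partProd_pair, isPartitionFamily_X.partProd_sup]
    exact Submodule.add_mem _ (Submodule.subset_span ⟨(_, _), rfl⟩)
      (Submodule.smul_mem _ _ (Submodule.subset_span ⟨(_, _), rfl⟩))
  · rw [letter_mul_TW h]
    exact Submodule.subset_span ⟨(_, _), rfl⟩

theorem proj_surjective (n : ℕ) : Function.Surjective (proj n) :=
  RingQuot.mkAlgHom_surjective K (Rel n)

theorem mul_mem_span_of_basisElt {x : BtAlg n}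
    (hx : ∀ r w, x * basisElt (r, w) ∈ Submodule.span K (Set.range (basisElt (n := n))))
    {y : BtAlg n} (hy : y ∈ Submodule.span K (Set.range (basisElt (n := n)))) :
    x * y ∈ Submodule.span K (Set.range (basisElt (n := n))) := by
  induction hy using Submodule.span_induction with
  | mem y hy => obtain ⟨⟨r, w⟩, rfl⟩ := hy; exact hx r w
  | zero => rw [mul_zero]; exact Submodule.zero_mem _
  | add y z _ _ hy hz => rw [mul_add]; exact Submodule.add_mem _ hy hz
  | smul c y _ hy => rw [mul_smul_comm]; exact Submodule.smul_mem _ _ hy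

theorem E_eq_X (i : Fin (n - 1)) : E i = X (lo i).succ (hi i).succ := by
  rw [X_succ_succ, EE_lo_hi]

theorem T_eq_letter (i : Fin (n - 1)) : T i = letter (hi i) := by
  rw [letter_of_ne (by simp [hi])]
  rfl

theorem span_basisElt (hn : 1 ≤ n) :
    Submodule.span K (Set.range (basisElt (n := n))) = ⊤ := by
  set S := Submodule.span K (Set.range (basisElt (n := n))) with hS
  have key : ∀ x : FreeAlgebra K (Gen n), ∀ y ∈ S, proj n x * y ∈ S := by
    intro x
    induction x using FreeAlgebra.induction with
    | grade0 c =>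
      intro y hy
      rw [AlgHom.commutes, ← Algebra.smul_def]
      exact Submodule.smul_mem _ _ hy
    | grade1 g =>
      intro y hy
      refine mul_mem_span_of_basisElt (fun r w => ?_) hy
      rcases g with _ | i | i | j
      · have h : (B : BtAlg n) = letter ⟨0, hn⟩ := (letter_of_eq rfl).symm
        change B * _ ∈ _
        rw [h]
        exact letter_mul_basisElt_mem _ r w
      · change T i * _ ∈ _
        rw [T_eq_letter]
        exact letter_mul_basisElt_mem _ r w
      · change E i * _ ∈ _
        rw [E_eq_X, X_mul_basisElt]
        exact Submodule.subset_span ⟨_, rfl⟩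
      · change F j * _ ∈ _
        rw [← X_zero_succ, X_mul_basisElt]
        exact Submodule.subset_span ⟨_, rfl⟩
    | mul x x' hx hx' =>
      intro y hy
      rw [map_mul, mul_assoc]
      exact hx _ (hx' _ hy)
    | add x x' hx hx' =>
      intro y hy
      rw [map_add, add_mul]
      exact Submodule.add_mem _ (hx _ hy) (hx' _ hy)
  have h1 : (1 : BtAlg n) ∈ S := by
    refine Submodule.subset_span ⟨(⊥, 1), ?_⟩
    rw [basisElt, isPartitionFamily_X.partProd_bot, TW_one, one_mul]
  rw [eq_top_iff]
  intro x _
  obtain ⟨x, rfl⟩ := proj_surjective n x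
  simpa using key x 1 h1

end Span

/-! ### The regular module: commuting left and right multiplications -/

section RegularModule

variable {n : ℕ}

/-- The free module on pairs of an equivalence relation on the strands and an element of `W_n`. -/
abbrev RegMod (n : ℕ) : Type := (Setoid (Fin (n + 1)) × W n) →₀ K

/-- The standard basis vectors. -/
noncomputable def bs (r : Setoid (Fin (n + 1))) (w : W n) : RegMod n := Finsupp.single (r, w) 1

theorem regMod_ext {f g : RegMod n →ₗ[K] RegMod n} (h : ∀ r w, f (bs r w) = g (bs r w)) :
    f = g := by
  refine Finsupp.lhom_ext' fun p => LinearMap.ext_ring ?_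
  exact h p.1 p.2

/-- The linear map with given values on the standard basis. -/
noncomputable def ofBasis (f : Setoid (Fin (n + 1)) → W n → RegMod n) :
    RegMod n →ₗ[K] RegMod n :=
  Finsupp.linearCombination K fun p => f p.1 p.2

theorem ofBasis_bs (f : Setoid (Fin (n + 1)) → W n → RegMod n) (r : Setoid (Fin (n + 1)))
    (w : W n) : ofBasis f (bs r w) = f r w := by
  simp [ofBasis, bs]

open Classical in
/-- The coefficient of the quadratic relation if `P` holds, and `0` otherwise. -/
noncomputable def coefIf (s : Fin n) (P : Prop) : K := if P then coef s else 0

/-- Left multiplication by the generator of a node. -/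
noncomputable def opL (s : Fin n) : Module.End K (RegMod n) := ofBasis fun r w =>
  bs (act ((cs n).simple s) r) ((cs n).simple s * w) +
    coefIf s (LDesc s w) • bs (nodeSetoid s ⊔ act ((cs n).simple s) r) w

/-- Left multiplication by an idempotent. -/
noncomputable def opE (J : Setoid (Fin (n + 1))) : Module.End K (RegMod n) :=
  ofBasis fun r w => bs (J ⊔ r) w

/-- Right multiplication by the generator of a node. -/
noncomputable def opR (t : Fin n) : Module.End K (RegMod n) := ofBasis fun r w =>
  bs r (w * (cs n).simple t) + coefIf t (Desc (phi w) t) • bs (r ⊔ act w (nodeSetoid t)) w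

/-- Right multiplication by an idempotent. -/
noncomputable def opRE (J : Setoid (Fin (n + 1))) : Module.End K (RegMod n) :=
  ofBasis fun r w => bs (r ⊔ act w J) w

theorem opL_bs (s : Fin n) (r : Setoid (Fin (n + 1))) (w : W n) : opL s (bs r w) =
    bs (act ((cs n).simple s) r) ((cs n).simple s * w) +
      coefIf s (LDesc s w) • bs (nodeSetoid s ⊔ act ((cs n).simple s) r) w := ofBasis_bs _ _ _

theorem opE_bs (J r : Setoid (Fin (n + 1))) (w : W n) : opE J (bs r w) = bs (J ⊔ r) w :=
  ofBasis_bs _ _ _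

theorem opR_bs (t : Fin n) (r : Setoid (Fin (n + 1))) (w : W n) : opR t (bs r w) =
    bs r (w * (cs n).simple t) +
      coefIf t (Desc (phi w) t) • bs (r ⊔ act w (nodeSetoid t)) w := ofBasis_bs _ _ _

theorem opRE_bs (J r : Setoid (Fin (n + 1))) (w : W n) : opRE J (bs r w) = bs (r ⊔ act w J) w :=
  ofBasis_bs _ _ _

theorem opE_mul (J J' : Setoid (Fin (n + 1))) : opE J * opE J' = opE (J ⊔ J') :=
  regMod_ext fun r w => by
    rw [Module.End.mul_apply, opE_bs, opE_bs, opE_bs, sup_assoc]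

theorem opE_bot : opE (⊥ : Setoid (Fin (n + 1))) = 1 :=
  regMod_ext fun r w => by rw [opE_bs, bot_sup_eq]; rfl

theorem opL_mul_opE (s : Fin n) (J : Setoid (Fin (n + 1))) :
    opL s * opE J = opE (act ((cs n).simple s) J) * opL s :=
  regMod_ext fun r w => by
    rw [Module.End.mul_apply, Module.End.mul_apply, opE_bs, opL_bs, opL_bs, map_add, map_smul,
      opE_bs, opE_bs, map_sup, sup_left_comm]

theorem node_sup_act (s : Fin n) (r : Setoid (Fin (n + 1))) :
    nodeSetoid s ⊔ (nodeSetoid s ⊔ r) = nodeSetoid s ⊔ r := by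
  rw [← sup_assoc, sup_idem]

theorem opL_sq (s : Fin n) :
    opL s * opL s = 1 + coef s • (opE (nodeSetoid s) * opL s) :=
  regMod_ext fun r w => by
    rw [LinearMap.add_apply, LinearMap.smul_apply, Module.End.mul_apply, Module.End.mul_apply,
      opL_bs, map_add, map_add, map_smul, map_smul, opL_bs, opL_bs, opE_bs, opE_bs,
      Module.End.one_apply, act_simple_simple, CoxeterSystem.simple_mul_simple_cancel_left,
      map_sup, act_simple_node, act_simple_simple]
    simp only [node_sup_act_simple, node_sup_act]
    by_cases h : LDesc s w
    · have h' : ¬ LDesc s ((cs n).simple s * w) := by rw [lDesc_simple_mul]; simpa using h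
      simp only [coefIf, if_pos h, if_neg h', zero_smul, add_zero]
    · have h' : LDesc s ((cs n).simple s * w) := by rw [lDesc_simple_mul]; simpa using h
      simp only [coefIf, if_neg h, if_pos h', zero_smul, add_zero]

theorem phi_simple_mul (s : Fin n) (w : W n) :
    phi ((cs n).simple s * w) = signedSwap s * phi w := by rw [map_mul, phi_simple]

theorem rootPair_facts {w : W n} {s t : Fin n} (h : RootPair (phi w) s t) :
    (cs n).simple s * w = w * (cs n).simple t ∧ act w (nodeSetoid t) = nodeSetoid s ∧
      coef s = coef t ∧ (Desc (phi w) t ↔ LDesc s w) := by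
  refine ⟨phi_injective ?_, act_node_of_rootPair h, ?_, ?_⟩
  · rw [map_mul, map_mul, phi_simple, phi_simple, h.conj (phi_neg w)]
  · simp only [coef, h.zero_iff (phi_neg w)]
  · rw [h.desc_iff (phi_neg w), LDesc, map_inv]

theorem rootPair_inv {w : W n} {s t : Fin n} (h : RootPair (phi w⁻¹) t s) :
    RootPair (phi w) s t := by
  have key : ∀ x y : ℤ, phi w⁻¹ x = y → phi w y = x := by
    rintro x _ rfl
    rw [map_inv]
    exact (phi w).apply_symm_apply x
  have hn := phi_neg w
  unfold RootPair at h ⊢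
  rcases h with ⟨h1, h2⟩ | ⟨h1, h2⟩ | ⟨h1, h2⟩ | ⟨h1, h2⟩
  · exact Or.inl ⟨key _ _ h1, key _ _ h2⟩
  · exact Or.inr (Or.inl ⟨key _ _ h2, key _ _ h1⟩)
  · have h1 := key _ _ h1
    have h2 := key _ _ h2
    rw [hn] at h1 h2
    exact Or.inr (Or.inr (Or.inl ⟨by omega, by omega⟩))
  · have h1 := key _ _ h1
    have h2 := key _ _ h2
    rw [hn] at h1 h2
    exact Or.inr (Or.inr (Or.inr ⟨by omega, by omega⟩))

/-- Left and right multiplication by generators change descents compatibly, except for a pair of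
corresponding roots. -/
theorem desc_cases (w : W n) (s t : Fin n) : RootPair (phi w) s t ∨
    ((Desc (phi ((cs n).simple s * w)) t ↔ Desc (phi w) t) ∧
      (LDesc s (w * (cs n).simple t) ↔ LDesc s w)) := by
  by_cases h1 : Desc (phi ((cs n).simple s * w)) t ↔ Desc (phi w) t
  · by_cases h2 : LDesc s (w * (cs n).simple t) ↔ LDesc s w
    · exact Or.inr ⟨h1, h2⟩
    · left
      apply rootPair_inv
      apply rootPair_of_desc (phi_neg w⁻¹)
      rwa [LDesc, mul_inv_rev, CoxeterSystem.inv_simple, phi_simple_mul] at h2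
  · left
    apply rootPair_of_desc (phi_neg w)
    rwa [phi_simple_mul] at h1

/-- If neither multiplication affects the descent seen by the other, the two expansions agree term
by term. Otherwise `w` matches the pairs of `s` and `t`, so `s w = w t`, the node relations
correspond, and the coefficients agree; the surviving terms coincide. -/
theorem opL_mul_opR (s t : Fin n) : opL s * opR t = opR t * opL s :=
  regMod_ext fun r w => by
    rw [Module.End.mul_apply, Module.End.mul_apply, opL_bs, opR_bs, map_add, map_add, map_smul,
      map_smul, opL_bs, opL_bs, opR_bs, opR_bs, map_sup]
    have h3 : nodeSetoid s ⊔ (act ((cs n).simple s) r ⊔ act ((cs n).simple s)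
          (act w (nodeSetoid t))) =
        nodeSetoid s ⊔ act ((cs n).simple s) r ⊔ act w (nodeSetoid t) := by
      rw [sup_left_comm, node_sup_act_simple, sup_left_comm, sup_assoc]
    rw [h3, act_mul, ← mul_assoc]
    rcases desc_cases w s t with h | ⟨h1, h2⟩
    · obtain ⟨e1, e2, e3, e4⟩ := rootPair_facts h
      have h5 : coefIf s (LDesc s (w * (cs n).simple t)) = coefIf s (¬ LDesc s w) := by
        rw [← e1, lDesc_simple_mul]
      have h6 : coefIf t (Desc (phi ((cs n).simple s * w)) t) = coefIf t (¬ Desc (phi w) t) := by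
        rw [e1, map_mul, phi_simple, desc_mul_signedSwap]
      rw [h5, h6, e2, act_simple_node, ← e1, e4, sup_comm (nodeSetoid s)]
      by_cases h7 : LDesc s w
      · simp only [coefIf, h7, not_true_eq_false, if_true, if_false, zero_smul, add_zero, e3]
      · simp only [coefIf, h7, not_false_eq_true, if_true, if_false, zero_smul, add_zero, e3]
    · rw [propext h1, propext h2]
      module

theorem opL_mul_opRE (s : Fin n) (J : Setoid (Fin (n + 1))) :
    opL s * opRE J = opRE J * opL s :=
  regMod_ext fun r w => by
    rw [Module.End.mul_apply, Module.End.mul_apply, opRE_bs, opL_bs, opL_bs, map_add, map_smul,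
      opRE_bs, opRE_bs, map_sup, act_mul, sup_left_comm, node_sup_act_simple, sup_left_comm,
      sup_assoc]

/-- An endomorphism that commutes with the right multiplications is determined by its value at
the unit vector. -/
theorem eq_of_commute {D D' : Module.End K (RegMod n)} (hR : ∀ t, D * opR t = opR t * D)
    (hE : ∀ J, D * opRE J = opRE J * D) (hR' : ∀ t, D' * opR t = opR t * D')
    (hE' : ∀ J, D' * opRE J = opRE J * D') (h : D (bs ⊥ 1) = D' (bs ⊥ 1)) : D = D' := by
  have key : ∀ (w : W n) r, D (bs r w) = D' (bs r w) := by
    intro w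
    induction w using (cs n).simple_induction_right with
    | one =>
      intro r
      have e : bs r (1 : W n) = opRE r (bs ⊥ 1) := by rw [opRE_bs, act_one, bot_sup_eq]
      rw [e, ← Module.End.mul_apply, hE, Module.End.mul_apply, h, ← Module.End.mul_apply, ← hE']
      rfl
    | mul_simple_right w t ih =>
      intro r
      -- The formula for `opR` is solved for its leading term, which holds whether or not `t` is a
      -- descent of `w`.
      have e : bs r (w * (cs n).simple t) = opR t (bs r w) -
          coefIf t (Desc (phi w) t) • bs (r ⊔ act w (nodeSetoid t)) w := by
        rw [opR_bs, add_sub_cancel_right]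
      rw [e, map_sub, map_sub, map_smul, map_smul, ih, ← Module.End.mul_apply, hR,
        Module.End.mul_apply, ih, ← Module.End.mul_apply, ← hR']
      rfl
  exact regMod_ext fun r w => key w r

theorem not_lDesc_of_isReduced {s : Fin n} {ω : List (Fin n)} (h : (cs n).IsReduced (s :: ω)) :
    ¬ LDesc s ((cs n).wordProd ω) := by
  rw [isReduced_iff] at h
  rw [LDesc, map_inv, phi_wordProd]
  exact fun h' => not_isMin_of_desc h' h

/-- Along a reduced word no letter is a left descent of what follows it, so the correction term
never appears. -/
theorem opL_prod_bs_bot {ω : List (Fin n)} (h : (cs n).IsReduced ω) :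
    (ω.map opL).prod (bs ⊥ 1) = bs ⊥ ((cs n).wordProd ω) := by
  induction ω with
  | nil => simp
  | cons s ω ih =>
    have h' : (cs n).IsReduced ω := by
      rw [isReduced_iff] at h ⊢
      exact h.of_cons
    rw [List.map_cons, List.prod_cons, Module.End.mul_apply, ih h', opL_bs, map_bot, coefIf,
      if_neg (not_lDesc_of_isReduced h), zero_smul, add_zero, CoxeterSystem.wordProd_cons]

theorem lDesc_wordProd_iff (s : Fin n) (ω : List (Fin n)) : LDesc s ((cs n).wordProd ω) ↔
    Desc (ω.reverse.map signedSwap).prod s := by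
  rw [LDesc, ← CoxeterSystem.wordProd_reverse, phi_wordProd]

theorem isReduced_nil : (cs n).IsReduced [] := by simp [CoxeterSystem.IsReduced]

theorem isReduced_one (s : Fin n) : (cs n).IsReduced [s] := by
  refine isReduced_cons isReduced_nil ?_
  rw [lDesc_wordProd_iff]
  simpa using not_desc_one s

theorem isReduced_two {s t : Fin n} (h : s ≠ t) : (cs n).IsReduced [s, t] := by
  refine isReduced_cons (isReduced_one t) ?_
  rw [lDesc_wordProd_iff]
  have h := Fin.val_ne_of_ne h
  have hs := loZ_hiZ s
  have ht := loZ_hiZ t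
  have h1 := signedSwap_spec t (loZ s)
  have h2 := signedSwap_spec t (hiZ s)
  simp only [List.reverse_cons, List.reverse_nil, List.nil_append, List.map_cons, List.map_nil,
    List.prod_cons, List.prod_nil, mul_one, Desc]
  rcases hs with hs | hs <;> rcases ht with ht | ht <;> omega

theorem isReduced_three {s t : Fin n} (h : s.val + 1 = t.val ∨ t.val + 1 = s.val) :
    (cs n).IsReduced [s, t, s] := by
  refine isReduced_cons (isReduced_two (by rintro rfl; omega)) ?_
  rw [lDesc_wordProd_iff]
  have hs := loZ_hiZ s
  have ht := loZ_hiZ t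
  have h1 := signedSwap_spec t (loZ s)
  have h2 := signedSwap_spec t (hiZ s)
  have h3 := signedSwap_spec s (signedSwap t (loZ s))
  have h4 := signedSwap_spec s (signedSwap t (hiZ s))
  simp only [List.reverse_cons, List.reverse_nil, List.nil_append, List.map_cons, List.map_nil,
    List.prod_cons, List.prod_nil, mul_one, Desc, List.cons_append, Equiv.Perm.mul_apply]
  rcases hs with hs | hs <;> rcases ht with ht | ht <;>
  rcases h1 with h1 | h1 | h1 | h1 | h1 <;> omega

theorem isReduced_four {s t : Fin n} (h : s.val = 0 ∧ t.val = 1 ∨ s.val = 1 ∧ t.val = 0) :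
    (cs n).IsReduced [s, t, s, t] := by
  refine isReduced_cons (isReduced_three (by omega)) ?_
  rw [lDesc_wordProd_iff]
  have hs := loZ_hiZ s
  have ht := loZ_hiZ t
  have h1 := signedSwap_spec s
  have h2 := signedSwap_spec t
  simp only [List.reverse_cons, List.reverse_nil, List.nil_append, List.map_cons, List.map_nil,
    List.prod_cons, List.prod_nil, mul_one, Desc, List.cons_append, Equiv.Perm.mul_apply]
  rcases h with h | h
  · rw [show loZ s = -1 by omega, show hiZ s = 1 by omega] at *
    rw [show loZ t = 1 by omega, show hiZ t = 2 by omega] at *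
    have e1 : signedSwap t 1 = 2 := by have := h2 1; omega
    have e2 : signedSwap s 2 = 2 := by have := h1 2; omega
    have e3 : signedSwap t 2 = 1 := by have := h2 2; omega
    rw [signedSwap_neg, signedSwap_neg, signedSwap_neg, e1, e2, e3]
    omega
  · rw [show loZ s = 1 by omega, show hiZ s = 2 by omega] at *
    rw [show loZ t = -1 by omega, show hiZ t = 1 by omega] at *
    have e1 : signedSwap t 1 = -1 := by have := h2 1; omega
    have e2 : signedSwap t 2 = 2 := by have := h2 2; omega
    have e3 : signedSwap s 2 = 1 := by have := h1 2; omega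
    have e4 : signedSwap s (-1) = -2 := by have := h1 (-1); omega
    rw [e1, e2, e3, e1, e4, signedSwap_neg, e2]
    omega

/-- Both products commute with right multiplications and agree at the unit vector. The braid
relations of the operators follow without expanding them. -/
theorem opL_prod_eq {ω ω' : List (Fin n)} (h : (cs n).IsReduced ω) (h' : (cs n).IsReduced ω')
    (hp : (cs n).wordProd ω = (cs n).wordProd ω') : (ω.map opL).prod = (ω'.map opL).prod := by
  have comm : ∀ (x : Module.End K (RegMod n)), (∀ s, opL s * x = x * opL s) →
      ∀ ω : List (Fin n), (ω.map opL).prod * x = x * (ω.map opL).prod := by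
    intro x hx ω
    refine (Commute.list_prod_right _ x fun z hz => ?_).eq.symm
    obtain ⟨s, -, rfl⟩ := List.mem_map.1 hz
    exact (hx s).symm
  apply eq_of_commute
  · exact fun t => comm _ (fun s => opL_mul_opR s t) ω
  · exact fun J => comm _ (fun s => opL_mul_opRE s J) ω
  · exact fun t => comm _ (fun s => opL_mul_opR s t) ω'
  · exact fun J => comm _ (fun s => opL_mul_opRE s J) ω'
  · rw [opL_prod_bs_bot h, opL_prod_bs_bot h', hp]

theorem isBraidFamily_opL : IsBraidFamily (opL (n := n)) where
  comm s t h := by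
    have hne : s ≠ t := by rintro rfl; omega
    have := opL_prod_eq (isReduced_two hne) (isReduced_two hne.symm) (by
      simpa [CoxeterSystem.wordProd] using isBraidFamily_simple.comm s t h)
    simpa using this
  braid s t h0 h := by
    have := opL_prod_eq (isReduced_three (Or.inl h)) (isReduced_three (Or.inr h)) (by
      simpa [CoxeterSystem.wordProd, mul_assoc] using isBraidFamily_simple.braid s t h0 h)
    simpa [mul_assoc] using this
  braid₄ s t h0 h := by
    have := opL_prod_eq (isReduced_four (Or.inl ⟨h0, h⟩)) (isReduced_four (Or.inr ⟨h, h0⟩)) (by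
      simpa [CoxeterSystem.wordProd, mul_assoc] using isBraidFamily_simple.braid₄ s t h0 h)
    simpa [mul_assoc] using this

end RegularModule

/-! ### The regular representation, linear independence and dimension -/

section Representation

variable {n : ℕ}

theorem strandSwap_hi (i : Fin (n - 1)) (j : Fin n) :
    strandSwap (hi i) j.succ = (Equiv.swap (lo i) (hi i) j).succ :=
  strandSwap_succ (s := hi i) (Nat.succ_ne_zero _) j

theorem strandSwap_of_eq {s : Fin n} (h : s.val = 0) : strandSwap s = 1 := if_pos h

theorem nodeSetoid_hi (i : Fin (n - 1)) :
    nodeSetoid (hi i) = pairSetoid (lo i).succ (hi i).succ := rfl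

theorem act_hi_pair (i : Fin (n - 1)) (a b : Fin n) :
    act ((cs n).simple (hi i)) (pairSetoid a.succ b.succ) =
      pairSetoid (Equiv.swap (lo i) (hi i) a).succ (Equiv.swap (lo i) (hi i) b).succ := by
  rw [act_pair, tau_simple, strandSwap_hi, strandSwap_hi]

theorem act_hi_node_of_far {i j : Fin (n - 1)} (h : Far i j) :
    act ((cs n).simple (hi j)) (nodeSetoid (hi i)) = nodeSetoid (hi i) := by
  unfold Far at h
  rw [nodeSetoid_hi, act_hi_pair, Equiv.swap_apply_of_ne_of_ne, Equiv.swap_apply_of_ne_of_ne] <;>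
    simp only [ne_eq, Fin.ext_iff, lo, hi] <;> omega

theorem act_hi_act_hi_node {i j : Fin (n - 1)} (h : Near i j) :
    act ((cs n).simple (hi j)) (act ((cs n).simple (hi i)) (nodeSetoid (hi j))) =
      nodeSetoid (hi i) := by
  unfold Near at h
  rw [nodeSetoid_hi, act_hi_pair, act_hi_pair, nodeSetoid_hi]
  have key : ∀ a b : Fin n, a.val + i.val = b.val + j.val → (a.val = j.val ∨ a.val = j.val + 1) →
      Equiv.swap (lo j) (hi j) (Equiv.swap (lo i) (hi i) a) = b := by
    intro a b hab ha
    have h1 := swap_lo_hi_val i a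
    have h2 := swap_lo_hi_val j (Equiv.swap (lo i) (hi i) a)
    apply Fin.ext
    split_ifs at h1 <;> split_ifs at h2 <;> omega
  rw [key _ (lo i) (by simp only [lo]; omega) (Or.inl rfl),
    key _ (hi i) (by simp only [hi]; omega) (Or.inr rfl)]

theorem node_sup_act_hi_node {i j : Fin (n - 1)} (h : Near i j) :
    nodeSetoid (hi j) ⊔ act ((cs n).simple (hi i)) (nodeSetoid (hi j)) =
      nodeSetoid (hi i) ⊔ nodeSetoid (hi j) := by
  rw [nodeSetoid_hi, act_hi_pair, nodeSetoid_hi]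
  refine eq_of_forall_ge_iff fun t => ?_
  rw [sup_le_iff, sup_le_iff, pairSetoid_le, pairSetoid_le, pairSetoid_le]
  rcases h with h | h
  · have e1 : lo j = hi i := Fin.ext h.symm
    have e2 : Equiv.swap (lo i) (hi i) (hi j) = hi j :=
      Equiv.swap_apply_of_ne_of_ne (by simp only [ne_eq, Fin.ext_iff, lo, hi]; omega)
        (by simp only [ne_eq, Fin.ext_iff, hi]; omega)
    rw [e1, e2, Equiv.swap_apply_right]
    exact ⟨fun ⟨p, q⟩ => ⟨t.trans' q (t.symm' p), p⟩, fun ⟨p, q⟩ => ⟨q, t.trans' p q⟩⟩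
  · have e1 : lo i = hi j := Fin.ext h.symm
    have e2 : Equiv.swap (lo i) (hi i) (lo j) = lo j :=
      Equiv.swap_apply_of_ne_of_ne (by simp only [ne_eq, Fin.ext_iff, lo]; omega)
        (by simp only [ne_eq, Fin.ext_iff, lo, hi]; omega)
    rw [e2, ← e1, Equiv.swap_apply_left]
    exact ⟨fun ⟨p, q⟩ => ⟨t.trans' (t.symm' p) q, p⟩, fun ⟨p, q⟩ => ⟨q, t.trans' q p⟩⟩

theorem act_zero {s : Fin n} (h : s.val = 0) (a b : Fin (n + 1)) :
    act ((cs n).simple s) (pairSetoid a b) = pairSetoid a b := by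
  rw [act_pair, tau_simple, strandSwap_of_eq h]
  rfl

theorem pair_sup_pair {α : Type*} (a b c : α) :
    pairSetoid b c ⊔ pairSetoid a b = pairSetoid a b ⊔ pairSetoid a c := by
  refine eq_of_forall_ge_iff fun t => ?_
  rw [sup_le_iff, sup_le_iff, pairSetoid_le, pairSetoid_le, pairSetoid_le]
  exact ⟨fun ⟨p, q⟩ => ⟨q, t.trans' q p⟩, fun ⟨p, q⟩ => ⟨t.trans' (t.symm' p) q, p⟩⟩

/-- The operators of the regular representation attached to the generators. -/
noncomputable def opGen (hn : 1 ≤ n) : Gen n → Module.End K (RegMod n)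
  | .b => opL ⟨0, hn⟩
  | .t i => opL (hi i)
  | .e i => opE (nodeSetoid (hi i))
  | .f j => opE (pairSetoid 0 j.succ)

theorem lift_opGen_rel (hn : 1 ≤ n) {x y : FreeAlgebra K (Gen n)} (h : Rel n x y) :
    FreeAlgebra.lift K (opGen hn) x = FreeAlgebra.lift K (opGen hn) y := by
  have hb : FreeAlgebra.lift K (opGen hn) b' = opL ⟨0, hn⟩ := FreeAlgebra.lift_ι_apply _ _
  have ht : ∀ i, FreeAlgebra.lift K (opGen hn) (t' i) = opL (hi i) :=
    fun i => FreeAlgebra.lift_ι_apply _ _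
  have he : ∀ i, FreeAlgebra.lift K (opGen hn) (e' i) = opE (nodeSetoid (hi i)) :=
    fun i => FreeAlgebra.lift_ι_apply _ _
  have hf : ∀ j, FreeAlgebra.lift K (opGen hn) (f' j) = opE (pairSetoid 0 j.succ) :=
    fun j => FreeAlgebra.lift_ι_apply _ _
  have h0 : ∀ i : Fin (n - 1), (hi i).val ≠ 0 := fun i => Nat.succ_ne_zero _
  cases h <;> simp only [map_mul, map_add, map_one, map_smul, hb, ht, he, hf]
  case t_comm i j h =>
    rcases h with h | h
    · exact isBraidFamily_opL.comm _ _ (by simp only [hi]; omega)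
    · exact (isBraidFamily_opL.comm _ _ (by simp only [hi]; omega)).symm
  case t_braid i j h => exact isBraidFamily_opL.braid _ _ (Nat.succ_pos _) (by simp only [hi]; omega)
  case t_sq i => rw [opL_sq, coef, if_neg (h0 i)]
  case e_sq i => rw [opE_mul, sup_idem]
  case e_comm i j => rw [opE_mul, opE_mul, sup_comm]
  case e_t i => rw [opL_mul_opE, act_simple_node]
  case e_t_far i j h => rw [opL_mul_opE, act_hi_node_of_far h]
  case e_e_t i j h =>
    rw [mul_assoc, mul_assoc, opE_mul, opL_mul_opE, map_sup, act_simple_node,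
      node_sup_act_simple, ← mul_assoc, opE_mul]
  case t_e_e i j h =>
    rw [mul_assoc, mul_assoc, opE_mul, opL_mul_opE, opL_mul_opE, map_sup, act_simple_node,
      node_sup_act_simple, ← mul_assoc, opE_mul, node_sup_act_hi_node h]
  case e_t_t i j h =>
    rw [mul_assoc (opL (hi j)), opL_mul_opE, ← mul_assoc (opL (hi j)), opL_mul_opE,
      act_hi_act_hi_node h]
  case b_t_braid i h =>
    exact isBraidFamily_opL.braid₄ _ _ rfl (by simp only [hi]; omega)
  case b_t_comm i h => exact isBraidFamily_opL.comm _ _ (by simp only [hi]; omega)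
  case b_sq j h =>
    obtain rfl : j = ⟨0, hn⟩ := Fin.ext h
    rw [opL_sq, coef, if_pos rfl]
    rfl
  case b_e i => rw [opL_mul_opE, nodeSetoid_hi, act_zero rfl]
  case f_sq j => rw [opE_mul, sup_idem]
  case b_f j => rw [opL_mul_opE, act_zero rfl]
  case f_e j i => rw [opE_mul, opE_mul, sup_comm]
  case f_t j i =>
    rw [opL_mul_opE, act_pair, tau_simple, strandSwap_zero, strandSwap_hi, Equiv.swap_apply_self]
  case e_f_lo i => rw [opE_mul, opE_mul, nodeSetoid_hi, pair_sup_pair]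
  case e_f_hi i =>
    rw [opE_mul, opE_mul, nodeSetoid_hi, pairSetoid_comm (lo i).succ, pair_sup_pair, sup_comm]

/-- The regular representation. -/
noncomputable def regRep (hn : 1 ≤ n) : BtAlg n →ₐ[K] Module.End K (RegMod n) :=
  RingQuot.liftAlgHom K ⟨FreeAlgebra.lift K (opGen hn), fun _ _ h => lift_opGen_rel hn h⟩

theorem regRep_proj (hn : 1 ≤ n) (g : Gen n) :
    regRep hn (proj n (FreeAlgebra.ι K g)) = opGen hn g := by
  refine (RingQuot.liftAlgHom_mkAlgHom_apply K _ _ _).trans ?_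
  exact FreeAlgebra.lift_ι_apply _ _

theorem regRep_letter (hn : 1 ≤ n) (s : Fin n) : regRep hn (letter s) = opL s := by
  by_cases h : s.val = 0
  · obtain rfl : s = ⟨0, hn⟩ := Fin.ext h
    rw [letter_of_eq rfl]
    exact regRep_proj hn Gen.b
  · rw [letter_of_ne h]
    refine (regRep_proj hn (Gen.t _)).trans ?_
    have : hi ⟨s.val - 1, by have := s.isLt; omega⟩ = s := Fin.ext (by simp only [hi]; omega)
    exact congrArg opL this

theorem exists_unit_regRep (hn : 1 ≤ n) (w : W n) : ∃ U : (BtAlg n)ˣ,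
    (∀ a b : Fin (n + 1), U * X a b = X (tau w a) (tau w b) * U) ∧
    ∀ J, regRep hn U * opE J = opE (act w J) * regRep hn U := by
  obtain ⟨ω, rfl⟩ := (cs n).wordProd_surjective w
  induction ω with
  | nil => exact ⟨1, fun a b => by simp, fun J => by simp [act_one]⟩
  | cons s ω ih =>
    obtain ⟨U, hU, hJ⟩ := ih
    have hs : (letterUnit s : BtAlg n) = letter s := rfl
    refine ⟨letterUnit s * U, fun a b => ?_, fun J => ?_⟩
    · rw [Units.val_mul, mul_assoc, hU, ← mul_assoc, hs, letter_X, mul_assoc,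
        CoxeterSystem.wordProd_cons, map_mul, tau_simple]
      rfl
    · rw [Units.val_mul, map_mul, hs, regRep_letter, mul_assoc, hJ, ← mul_assoc, opL_mul_opE,
        mul_assoc, CoxeterSystem.wordProd_cons, act_mul]

/-- Only `F_j` and the `E_i` are generators. A general `E_{i,j}` is conjugate to some `E_k` by a
unit whose image moves the operators `opE` in the same way. -/
theorem regRep_X (hn : 1 ≤ n) (a b : Fin (n + 1)) :
    regRep hn (X a b) = opE (pairSetoid a b) := by
  have hself : ∀ a : Fin (n + 1), regRep hn (X a a) = opE (pairSetoid a a) := by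
    intro a
    have : pairSetoid a a = ⊥ := bot_unique (pairSetoid_le.2 (Setoid.refl' _ a))
    rw [X_self, map_one, this, opE_bot]
  have hsucc : ∀ i j : Fin n, i ≠ j →
      regRep hn (X i.succ j.succ) = opE (pairSetoid i.succ j.succ) := by
    intro i j hij
    obtain ⟨k, e, -, rfl, rfl⟩ := exists_perm_two hij
    obtain ⟨w, hw⟩ := exists_tau_succ e
    obtain ⟨U, hU, hJ⟩ := exists_unit_regRep hn w
    have h1 := congrArg (regRep hn) (hU (lo k).succ (hi k).succ)
    have h2 : regRep hn (X (lo k).succ (hi k).succ) = opE (nodeSetoid (hi k)) := by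
      rw [← E_eq_X]
      exact regRep_proj hn (Gen.e k)
    rw [map_mul, map_mul, hw, hw, h2, hJ, nodeSetoid_hi, act_pair, hw, hw] at h1
    exact ((U.isUnit.map (regRep hn)).mul_left_inj.1 h1).symm
  by_cases hab : a = b
  · rw [hab, hself]
  rcases Fin.eq_zero_or_eq_succ a with rfl | ⟨i, rfl⟩ <;>
    rcases Fin.eq_zero_or_eq_succ b with rfl | ⟨j, rfl⟩
  · exact hself 0
  · exact regRep_proj hn (Gen.f j)
  · rw [X_comm, pairSetoid_comm]
    exact regRep_proj hn (Gen.f i)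
  · exact hsucc i j fun h => hab (congrArg Fin.succ h)

theorem regRep_partProd (hn : 1 ≤ n) (r : Setoid (Fin (n + 1))) :
    regRep hn (partProd X r) = opE r := by
  -- The relation generated by the list is described by its upper bounds, which determine it.
  have key : ∀ P : List (Fin (n + 1) × Fin (n + 1)), ∃ q : Setoid (Fin (n + 1)),
      regRep hn (P.map fun p => X p.1 p.2).prod = opE q ∧ ∀ t, q ≤ t ↔ ∀ p ∈ P, t p.1 p.2 := by
    intro P
    induction P with
    | nil => exact ⟨⊥, by simp [opE_bot], by simp⟩
    | cons p P ih =>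
      obtain ⟨q, h1, h2⟩ := ih
      refine ⟨pairSetoid p.1 p.2 ⊔ q, ?_, fun t => ?_⟩
      · rw [List.map_cons, List.prod_cons, map_mul, h1, regRep_X, opE_mul]
      · rw [sup_le_iff, pairSetoid_le, h2, List.forall_mem_cons]
  classical
  rw [partProd]
  obtain ⟨q, h1, h2⟩ :=
    key ((Finset.univ : Finset (Fin (n + 1) × Fin (n + 1))).toList.filter fun p => r p.1 p.2)
  have hq : q = r := eq_of_forall_ge_iff fun t => by
    rw [h2]
    exact ⟨fun h a b hab => h (a, b) (by simpa using hab), fun h p hp => h (by simpa using hp)⟩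
  rw [hq] at h1
  exact h1

theorem regRep_TW (hn : 1 ≤ n) (w : W n) : regRep hn (TW w) (bs ⊥ 1) = bs ⊥ w := by
  obtain ⟨ω, hω, rfl⟩ := (cs n).exists_isReduced w
  have h : regRep hn (TW ((cs n).wordProd ω)) = (ω.map opL).prod := by
    rw [TW_wordProd hω, wordT, map_list_prod, List.map_map]
    congr 2
    funext s
    exact regRep_letter hn s
  rw [h, opL_prod_bs_bot hω]

theorem regRep_basisElt (hn : 1 ≤ n) (p : Setoid (Fin (n + 1)) × W n) :
    regRep hn (basisElt p) (bs ⊥ 1) = Finsupp.single p 1 := by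
  rw [basisElt, map_mul, Module.End.mul_apply, regRep_TW, regRep_partProd, opE_bs, sup_bot_eq]
  rfl

/-- Evaluation at the unit vector is linear and sends these elements to the standard basis. -/
theorem linearIndependent_basisElt (hn : 1 ≤ n) :
    LinearIndependent K (basisElt (n := n)) := by
  let ev : BtAlg n →ₗ[K] RegMod n :=
    (LinearMap.applyₗ (bs ⊥ 1)).comp (regRep hn).toLinearMap
  refine LinearIndependent.of_comp ev ?_
  have : ev ∘ basisElt = fun p => Finsupp.single p (1 : K) := funext (regRep_basisElt hn)
  rw [this]
  exact Finsupp.linearIndependent_single_one K _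

/-- The basis of the algebra indexed by set partitions and elements of `W_n`. -/
noncomputable def btBasis (hn : 1 ≤ n) : Module.Basis (SetPart n × W n) K (BtAlg n) :=
  (Module.Basis.mk (linearIndependent_basisElt hn) (span_basisElt hn).ge).reindex
    ((Equiv.ofBijective partSetoid partSetoid_bijective).prodCongr (Equiv.refl (W n))).symm

theorem btBasis_apply (hn : 1 ≤ n) (I : SetPart n) (w : W n) :
    btBasis hn (I, w) = EF I * TW w := by
  rw [btBasis, Module.Basis.reindex_apply, Module.Basis.mk_apply, EF_eq]
  rfl

theorem finrank_btAlg (hn : 1 ≤ n) :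
    Module.finrank K (BtAlg n) = Nat.bell (n + 1) * 2 ^ n * n.factorial := by
  rw [Module.finrank_eq_nat_card_basis (btBasis hn), Nat.card_prod, card_W,
    Nat.card_congr (Equiv.ofBijective partSetoid partSetoid_bijective), card_setoid, Nat.card_fin,
    mul_assoc]

end Representation

end BtB

theorem mainTheorem1 (n : ℕ) (hn : 1 ≤ n) :
    (∀ ω : List (Fin n), (BtB.cs n).IsReduced ω →
      BtB.TW ((BtB.cs n).wordProd ω) = BtB.wordT ω) ∧
    (∃ b : Module.Basis (BtB.SetPart n × BtB.W n) BtB.K (BtB.BtAlg n),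
      ∀ (I : BtB.SetPart n) (w : BtB.W n), b (I, w) = BtB.EF I * BtB.TW w) ∧
    Module.finrank BtB.K (BtB.BtAlg n) = Nat.bell (n + 1) * 2 ^ n * n.factorial :=
  ⟨fun _ h => BtB.TW_wordProd h, ⟨BtB.btBasis hn, BtB.btBasis_apply hn⟩, BtB.finrank_btAlg hn⟩
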